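/- Let $k$ be an algebraically closed field of characteristic $0$. Let $\mathcal C$ be a Group category over $k$, i.e. an abelian $k$-linear monoidal category with $k$-bilinear tensor product, such that: every object is a finite direct sum of scalar objects (objects $X$ with $\mathrm{End}(X)=k$); the scalar objects are simple, the unit $I$ is scalar, and the set $\Lambda_{\mathcal C}$ of isomorphism classes of scalar objects is finite; $\mathcal C$ is sovereign (every object $X$ has a two-sided dual $X^\vee$, the left and right dualities agreeing as monoidal functors); left and right quantum traces coincide (so $\mathcal C$ is spherical); and every scalar object is invertible. Suppose that $\dim(X)=1$ for every scalar object $X$. Let $G=\Lambda_{\mathcal C}$ be the underlying group (product induced by $\otimes$, inverse by $X\mapsto X^\vee$). Choose representatives $X_g$ $(g\in G)$, and let $\alpha\in Z^3(G,k^*)$ be the associativity constraint of $\mathcal C$: for some nonzero $\varphi(g,h)\in \mathrm{Hom}(X_{gh},X_g\otimes X_h)$, $$\alpha(g,h,i)\,(\mathrm{id}_{X_g}\otimes\varphi(h,i))\,\varphi(g,hi)=a_{X_g,X_h,X_i}\,(\varphi(g,h)\otimes \mathrm{id}_{X_i})\,\varphi(gh,i)\qquad(g,h,i\in G),$$ where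 $a_{X,Y,Z}:(X\otimes Y)\otimes Z\to X\otimes(Y\otimes Z)$ is the associativity isomorphism. Then for every closed oriented $3$-manifold $M$ $$DW_{G,\alpha}(M)=TV_{\mathcal C}(M).$$ Here both invariants are computed from a triangulation $T$ of $M$ with $n_0$ vertices and an ordering of the vertices, and the equality holds for every such $T$ and every ordering. They are defined as follows. * $DW_{G,\alpha}(M)=|G|^{-n_0}\sum_\gamma\prod_{\Delta}\alpha(\gamma(01),\gamma(12),\gamma(23))^{\epsilon_\Delta}$. The sum is over all functions $\gamma$ from the oriented edges of $T$ to $G$ with $\gamma(\bar e)=\gamma(e)^{-1}$ and $\gamma(01)\gamma(12)\gamma(20)=1$ on every $2$-simplex; the product is over the $3$-simplices $\Delta=(0123)$ with vertices in ascending order; $\epsilon_\Delta=1$ if this order gives the orientation of $M$, and $\epsilon_\Delta=-1$ otherwise. * $TV_{\mathcal C}(M)=\bigl(\sum_{g\in\Lambda_{\mathcal C}}\dim(X_g)^2\bigr)^{-n_0}\sum_\gamma\prod_e\dim(\gamma(e))\,Z(M,\gamma)$. The sum is over all functions $\gamma$ from the oriented edges to $\Lambda_{\mathcal C}$ with $\gamma(\bar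 e)=\gamma(e)^\vee$, the product over the edges of $T$. An edge $ij$ with $i<j$ carries the object $X_{\gamma(ij)}$ and the opposite edge $ji$ its dual; write $\gamma(ij)$ for these objects too and put $V(abc)=\mathrm{Hom}(I,\gamma(ab)\otimes\gamma(bc)\otimes\gamma(ca))$. For a $3$-simplex numbered $(0123)$ compatibly with the orientation of $M$ (the ascending numbering if it is positive, otherwise the one with its two middle vertices exchanged), let $$L:V(132)\otimes V(023)\otimes V(031)\otimes V(012)\to k$$ be $\dim(\gamma(13))^{-1}$ times the adjoint, with respect to the trace forms $\mathrm{tr}(fg)$, of the 6j-symbol $\mathrm{Hom}(a,e\otimes d)\otimes \mathrm{Hom}(e,b\otimes c)\to \mathrm{Hom}(a,b\otimes f)\otimes \mathrm{Hom}(f,c\otimes d)$ induced by the associativity isomorphism, for $(a,b,c,d,e,f)=(\gamma(03),\gamma(01),\gamma(12),\gamma(23),\gamma(02),\gamma(13))$; the spaces $V$ are identified with the Hom-spaces by duality. Then $Z(M,\gamma)\in k$ is obtained from the tensor product of the forms $L$ over all $3$-simplices by contracting, along every $2$-simplex $abc$, by means of the non-degenerate pairing $V(abc)\otimes V(acb)\to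 k$, $f\otimes g\mapsto g^\vee f$ (the spaces $V(abc)$, $V(bca)$, $V(cab)$ being identified by rotation). -/

import Mathlib

open CategoryTheory MonoidalCategory Limits
open scoped TensorProduct

universe w v u

noncomputable section

namespace DWTV

/-! ## Sovereign categories, scalar objects, spherical categories -/

/-- A sovereign structure on a monoidal category: every object `X` has a chosen object `X^∨`
which is at the same time a right dual (`η_X : I ⟶ X ⊗ X^∨`, `ε_X : X^∨ ⊗ X ⟶ I`) and a left
dual (`h_X : I ⟶ X^∨ ⊗ X`, `e_X : X ⊗ X^∨ ⟶ I`), in such a way that the right and the left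
duality agree as (contravariant) monoidal functors: they agree on morphisms, and they have the
same comparison isomorphisms `(X ⊗ Y)^∨ ≅ Y^∨ ⊗ X^∨` and `I^∨ ≅ I`. -/
class Sovereign (C : Type u) [Category.{v} C] [MonoidalCategory C] where
  /-- the dual object `X^∨` -/
  dual : C → C
  /-- `η_X` and `ε_X` -/
  rightPairing : ∀ X : C, ExactPairing X (dual X)
  /-- `h_X` and `e_X` -/
  leftPairing : ∀ X : C, ExactPairing (dual X) X
  mate_eq : ∀ {X Y : C} (f : X ⟶ Y),
    @rightAdjointMate C _ _ X Y (@HasRightDual.mk C _ _ X (dual X) (rightPairing X))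
        (@HasRightDual.mk C _ _ Y (dual Y) (rightPairing Y)) f =
      @leftAdjointMate C _ _ X Y (@HasLeftDual.mk C _ _ X (dual X) (leftPairing X))
        (@HasLeftDual.mk C _ _ Y (dual Y) (leftPairing Y)) f
  tensor_eq : ∀ X Y : C,
    (rightDualIso (rightPairing (X ⊗ Y))
        (@ExactPairing.tensor C _ _ X Y (dual X) (dual Y) (rightPairing X) (rightPairing Y))).hom =
      (leftDualIso (leftPairing (X ⊗ Y))
        (@ExactPairing.tensor C _ _ (dual Y) (dual X) Y X (leftPairing Y) (leftPairing X))).hom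
  unit_eq :
    (rightDualIso (rightPairing (𝟙_ C)) exactPairingUnit).hom =
      (leftDualIso (leftPairing (𝟙_ C)) exactPairingUnit).hom

open Sovereign (dual rightPairing leftPairing)

/-- The coevaluation `I ⟶ X ⊗ Y` of an exact pairing. -/
abbrev coev {C : Type u} [Category.{v} C] [MonoidalCategory C] {X Y : C}
    (P : ExactPairing X Y) : 𝟙_ C ⟶ X ⊗ Y :=
  @ExactPairing.coevaluation C _ _ X Y P

/-- The evaluation `Y ⊗ X ⟶ I` of an exact pairing. -/
abbrev ev {C : Type u} [Category.{v} C] [MonoidalCategory C] {X Y : C}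
    (P : ExactPairing X Y) : Y ⊗ X ⟶ 𝟙_ C :=
  @ExactPairing.evaluation C _ _ X Y P

attribute [local instance] Abelian.hasFiniteBiproducts

section Basics

variable (k : Type w) [Field k] {C : Type u} [Category.{v} C] [Abelian C] [Linear k C]

/-- A scalar object: `End(X) = k`. -/
def IsScalar (X : C) : Prop := Function.Bijective (fun c : k => c • 𝟙 X)

variable (C) in
/-- Isomorphism of scalar objects, as an equivalence relation. -/
def scalarSetoid : Setoid {X : C // IsScalar k X} where
  r X Y := Nonempty (X.1 ≅ Y.1)
  iseqv := ⟨fun _ => ⟨Iso.refl _⟩, fun ⟨i⟩ => ⟨i.symm⟩, fun ⟨i⟩ ⟨j⟩ => ⟨i ≪≫ j⟩⟩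

variable (C) in
/-- The set `Λ_C` of isomorphism classes of scalar objects. -/
def ScalarClass : Type u := Quotient (scalarSetoid k C)

/-- The class of a scalar object. -/
def ScalarClass.mk (X : C) (hX : IsScalar k X) : ScalarClass k C :=
  Quotient.mk (scalarSetoid k C) ⟨X, hX⟩

variable {k}

theorem ScalarClass.mk_eq_mk {X Y : C} (hX : IsScalar k X) (hY : IsScalar k Y) :
    ScalarClass.mk k X hX = ScalarClass.mk k Y hY ↔ Nonempty (X ≅ Y) :=
  Quotient.eq (r := scalarSetoid k C)

theorem isScalar_iff_finrank {X : C} : IsScalar k X ↔ Module.finrank k (X ⟶ X) = 1 := by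
  constructor
  · rintro ⟨h1, h2⟩
    have hne : 𝟙 X ≠ 0 := by
      intro h0
      have : (0 : k) = 1 := h1 (by simp [h0])
      exact zero_ne_one this
    exact (finrank_eq_one_iff_of_nonzero' (𝟙 X) hne).2 fun f => h2 f
  · intro h
    have hne : 𝟙 X ≠ 0 := by
      intro h0
      have hz : ∀ f : X ⟶ X, f = 0 := fun f => by rw [← Category.id_comp f, h0, zero_comp]
      have : Subsingleton (X ⟶ X) := ⟨fun a b => by rw [hz a, hz b]⟩
      rw [Module.finrank_zero_of_subsingleton] at h
      exact zero_ne_one h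
    refine ⟨fun a b hab => ?_, fun f => (finrank_eq_one_iff_of_nonzero' (𝟙 X) hne).1 h f⟩
    have : (a - b) • 𝟙 X = 0 := by simpa [sub_smul, sub_eq_zero] using hab
    rcases smul_eq_zero.1 this with h' | h'
    · exact sub_eq_zero.1 h'
    · exact absurd h' hne

theorem IsScalar.id_ne_zero {X : C} (hX : IsScalar k X) : 𝟙 X ≠ 0 := by
  intro h0
  have : (0 : k) = 1 := hX.1 (by simp [h0])
  exact zero_ne_one this

theorem IsScalar.of_iso {X Y : C} (hX : IsScalar k X) (i : X ≅ Y) : IsScalar k Y := by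
  rw [isScalar_iff_finrank] at hX ⊢
  rw [← hX]
  exact ((Linear.homCongr k i i).finrank_eq).symm

end Basics

section Monoidal

variable (k : Type w) [Field k] (C : Type u) [Category.{v} C] [Abelian C] [Linear k C]
  [MonoidalCategory C]

/-- The underlying category of a finitely semisimple monoidal category: every object is a finite
direct sum of scalar objects, the scalar objects are the simple objects, there are finitely many
of them up to isomorphism, and the unit object is scalar. (The sovereign structure, the abelian
structure and the bilinearity of the tensor product are carried by other classes.) -/
class FinitelySemisimple : Prop where
  exists_iso_biproduct : ∀ X : C, ∃ (n : ℕ) (S : Fin n → C),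
    (∀ i, IsScalar k (S i)) ∧ Nonempty (X ≅ ⨁ S)
  simple_of_isScalar : ∀ X : C, IsScalar k X → Simple X
  isScalar_unit : IsScalar k (𝟙_ C)
  finite_scalarClass : Finite (ScalarClass k C)

instance [FinitelySemisimple k C] : Finite (ScalarClass k C) :=
  FinitelySemisimple.finite_scalarClass

instance [FinitelySemisimple k C] : Fintype (ScalarClass k C) := Fintype.ofFinite _

variable {C}

section Trace

variable [Sovereign C]

/-- The left quantum trace `e_X (f ⊗ id) η_X`. -/
def leftTrace {X : C} (f : X ⟶ X) : 𝟙_ C ⟶ 𝟙_ C :=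
  coev (rightPairing X) ≫ f ▷ dual X ≫ ev (leftPairing X)

/-- The right quantum trace `ε_X (id ⊗ f) h_X`. -/
def rightTrace {X : C} (f : X ⟶ X) : 𝟙_ C ⟶ 𝟙_ C :=
  coev (leftPairing X) ≫ dual X ◁ f ≫ ev (rightPairing X)

end Trace

variable (C) in
/-- A spherical category: a finitely semisimple (sovereign) monoidal category in which left and
right traces coincide. -/
class Spherical [Sovereign C] : Prop extends FinitelySemisimple k C where
  trace_eq : ∀ {X : C} (f : X ⟶ X), leftTrace f = rightTrace f

/-- An object `X` is invertible if `X ⊗ Y ≅ I` for some `Y`. -/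
def IsInvertible (X : C) : Prop := ∃ Y : C, Nonempty (X ⊗ Y ≅ 𝟙_ C)

variable (C) in
/-- A Group category: a pointed spherical category, that is, one in which every scalar object is
invertible. -/
class GroupCategory [Sovereign C] : Prop extends Spherical k C where
  isInvertible_of_isScalar : ∀ X : C, IsScalar k X → IsInvertible X

variable (C) in
/-- The identification `k = End(I)`. -/
def unitEquiv [FinitelySemisimple k C] : k ≃ₗ[k] (𝟙_ C ⟶ 𝟙_ C) :=
  LinearEquiv.ofBijective (LinearMap.toSpanSingleton k _ (𝟙 (𝟙_ C)))
    (FinitelySemisimple.isScalar_unit (k := k) (C := C))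

variable [MonoidalPreadditive C] [MonoidalLinear k C]

/-- The quantum trace, as a linear form on `End(X)`. -/
def qtrace [FinitelySemisimple k C] [Sovereign C] (X : C) : (X ⟶ X) →ₗ[k] k where
  toFun f := (unitEquiv k C).symm (leftTrace f)
  map_add' f g := by simp [leftTrace]
  map_smul' c f := by simp [leftTrace]

/-- The quantum dimension `dim(X) = tr(id_X)`. -/
def qdim [FinitelySemisimple k C] [Sovereign C] (X : C) : k := qtrace k X (𝟙 X)

/-- Bending the right factor of a tensor product, `Hom(X ⊗ Y, Z) ≅ Hom(X, Z ⊗ Y')`. -/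
def bendRight (X Y Y' Z : C) (P : ExactPairing Y Y') : (X ⊗ Y ⟶ Z) ≃ₗ[k] (X ⟶ Z ⊗ Y') :=
  { tensorRightHomEquiv X Y Y' Z with
    map_add' := fun f g => by simp [tensorRightHomEquiv]
    map_smul' := fun c f => by simp [tensorRightHomEquiv] }

/-- Bending the left factor of a tensor product, `Hom(Y' ⊗ X, Z) ≅ Hom(X, Y ⊗ Z)`. -/
def bendLeft (X Y Y' Z : C) (P : ExactPairing Y Y') : (Y' ⊗ X ⟶ Z) ≃ₗ[k] (X ⟶ Y ⊗ Z) :=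
  { tensorLeftHomEquiv X Y Y' Z with
    map_add' := fun f g => by simp [tensorLeftHomEquiv]
    map_smul' := fun c f => by simp [tensorLeftHomEquiv] }

variable {k}

theorem isScalar_of_exactPairing {X Y : C} (P : ExactPairing X Y) (hX : IsScalar k X) :
    IsScalar k Y := by
  rw [isScalar_iff_finrank] at hX ⊢
  rw [← hX]
  have e1 := Linear.homCongr k (ρ_ Y).symm (Iso.refl Y)
  have e2 := bendLeft k (𝟙_ C) X Y Y P
  have e3 := bendRight k (𝟙_ C) X Y X P
  have e4 := Linear.homCongr k (λ_ X).symm (Iso.refl X)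
  exact ((e1.trans e2).trans (e4.trans e3).symm).finrank_eq

end Monoidal

section Semisimple

variable (k : Type w) [Field k] {C : Type u} [Category.{v} C] [Abelian C] [Linear k C]
  [MonoidalCategory C] [FinitelySemisimple k C]

theorem exists_decomposition (X : C) : ∃ (n : ℕ) (S : Fin n → C) (i : ∀ j, S j ⟶ X)
    (p : ∀ j, X ⟶ S j), (∀ j, IsScalar k (S j)) ∧ ∑ j, p j ≫ i j = 𝟙 X := by
  obtain ⟨n, S, hS, ⟨θ⟩⟩ := FinitelySemisimple.exists_iso_biproduct (k := k) X
  refine ⟨n, S, fun j => biproduct.ι S j ≫ θ.inv, fun j => θ.hom ≫ biproduct.π S j, hS, ?_⟩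
  have h := biproduct.total (f := S)
  calc ∑ j, (θ.hom ≫ biproduct.π S j) ≫ biproduct.ι S j ≫ θ.inv
      = θ.hom ≫ (∑ j, biproduct.π S j ≫ biproduct.ι S j) ≫ θ.inv := by
        rw [Preadditive.sum_comp, Preadditive.comp_sum]
        exact Finset.sum_congr rfl fun j _ => by simp
    _ = 𝟙 X := by rw [h]; simp

variable {k}

theorem isIso_of_ne_zero {S T : C} (hS : IsScalar k S) (hT : IsScalar k T) {f : S ⟶ T}
    (hf : f ≠ 0) : IsIso f := by
  have := FinitelySemisimple.simple_of_isScalar S hS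
  have := FinitelySemisimple.simple_of_isScalar T hT
  exact isIso_of_hom_simple hf

theorem finite_hom_scalar {S T : C} (hS : IsScalar k S) (hT : IsScalar k T) :
    Module.Finite k (S ⟶ T) := by
  by_cases h : ∃ f : S ⟶ T, f ≠ 0
  · obtain ⟨f, hf⟩ := h
    have := isIso_of_ne_zero hS hT hf
    have h1 := isScalar_iff_finrank.1 hS
    have : Module.Finite k (S ⟶ S) := Module.finite_of_finrank_eq_succ h1
    exact Module.Finite.equiv (Linear.homCongr k (Iso.refl S) (asIso f))
  · push Not at h
    have : Subsingleton (S ⟶ T) := ⟨fun a b => by rw [h a, h b]⟩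
    infer_instance

variable (k)

theorem finite_hom (X Y : C) : Module.Finite k (X ⟶ Y) := by
  obtain ⟨n, S, i, p, hS, hX⟩ := exists_decomposition k X
  obtain ⟨m, T, i', p', hT, hY⟩ := exists_decomposition k Y
  have : ∀ a b, Module.Finite k (S a ⟶ T b) := fun a b => finite_hom_scalar (hS a) (hT b)
  let F : (X ⟶ Y) →ₗ[k] (∀ a b, S a ⟶ T b) :=
    { toFun := fun f a b => i a ≫ f ≫ p' b
      map_add' := fun f g => by ext; simp
      map_smul' := fun c f => by ext; simp }
  refine FiniteDimensional.of_injective F ?_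
  intro f g hfg
  have key : ∀ f : X ⟶ Y, f = ∑ a, ∑ b, p a ≫ (F f a b) ≫ i' b := by
    intro f
    calc f = (∑ a, p a ≫ i a) ≫ f ≫ (∑ b, p' b ≫ i' b) := by rw [hX, hY]; simp
      _ = _ := by
        simp [F, Preadditive.sum_comp, Preadditive.comp_sum]
        rw [Finset.sum_comm]
  rw [key f, key g, hfg]

/-- Composition `Hom(W, I) × Hom(I, W) → End(I) = k`. -/
def unitPairing (W : C) : (W ⟶ 𝟙_ C) →ₗ[k] (𝟙_ C ⟶ W) →ₗ[k] k :=
  LinearMap.mk₂ k (fun g f => (unitEquiv k C).symm (f ≫ g))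
    (fun _ _ _ => by simp) (fun _ _ _ => by simp) (fun _ _ _ => by simp) (fun _ _ _ => by simp)

instance unitPairing_isPerfPair (W : C) : (unitPairing k W).IsPerfPair := by
  have := finite_hom k W (𝟙_ C)
  have hI : IsScalar k (𝟙_ C) := FinitelySemisimple.isScalar_unit
  obtain ⟨n, S, i, p, hS, hW⟩ := exists_decomposition k W
  have hval : ∀ {S : C} (a : 𝟙_ C ⟶ S) (b : S ⟶ 𝟙_ C),
      a ≫ b = 𝟙 _ → (unitEquiv k C).symm (a ≫ b) ≠ 0 := by
    intro S a b hab h0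
    rw [LinearEquiv.map_eq_zero_iff, hab] at h0
    exact hI.id_ne_zero h0
  refine LinearMap.IsPerfPair.of_injective ?_ ?_
  · rw [injective_iff_map_eq_zero]
    intro g hg
    by_contra hne
    have : ∃ j, i j ≫ g ≠ 0 := by
      by_contra hall
      push Not at hall
      apply hne
      rw [← Category.id_comp g, ← hW, Preadditive.sum_comp]
      exact Finset.sum_eq_zero fun j _ => by rw [Category.assoc, hall j, comp_zero]
    obtain ⟨j, hj⟩ := this
    have := isIso_of_ne_zero (hS j) hI hj
    have h1 := congrArg (fun φ => φ (inv (i j ≫ g) ≫ i j)) hg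
    simp only [unitPairing, LinearMap.mk₂_apply, LinearMap.zero_apply] at h1
    exact hval (inv (i j ≫ g) ≫ i j) g (by simp) h1
  · rw [injective_iff_map_eq_zero]
    intro f hf
    by_contra hne
    have : ∃ j, f ≫ p j ≠ 0 := by
      by_contra hall
      push Not at hall
      apply hne
      rw [← Category.comp_id f, ← hW, Preadditive.comp_sum]
      exact Finset.sum_eq_zero fun j _ => by rw [← Category.assoc, hall j, zero_comp]
    obtain ⟨j, hj⟩ := this
    have := isIso_of_ne_zero hI (hS j) hj
    have h1 := congrArg (fun φ => φ (p j ≫ inv (f ≫ p j))) hf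
    simp only [unitPairing, LinearMap.flip_apply, LinearMap.mk₂_apply,
      LinearMap.zero_apply] at h1
    exact hval f (p j ≫ inv (f ≫ p j)) (by rw [← Category.assoc]; simp) h1

end Semisimple

/-! ## The group of scalar objects of a Group category -/

theorem dual_iso {C : Type u} [Category.{v} C] [MonoidalCategory C] [Sovereign C] {X Y : C}
    (i : X ≅ Y) : Nonempty (dual X ≅ dual Y) :=
  ⟨rightDualIso (rightPairing X)
    (@exactPairingCongrLeft C _ _ X Y (dual Y) (rightPairing Y) i)⟩

/-- If `B ⊗ Z ≅ I` and `A` is a scalar object dual to `B`, then the evaluation `B ⊗ A ⟶ I` is an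
isomorphism. -/
theorem isIso_ev {k : Type w} [Field k] {C : Type u} [Category.{v} C] [Abelian C] [Linear k C]
    [MonoidalCategory C] [MonoidalPreadditive C] [FinitelySemisimple k C] {A B Z : C} (P : ExactPairing A B)
    (hA : IsScalar k A) (θ : B ⊗ Z ≅ 𝟙_ C) : IsIso (ev P) := by
  have := FinitelySemisimple.simple_of_isScalar A hA
  have hI : 𝟙 (𝟙_ C) ≠ 0 :=
    (FinitelySemisimple.isScalar_unit (k := k) (C := C)).id_ne_zero
  let ψ : Z ⟶ A := tensorLeftHomEquiv Z A B (𝟙_ C) θ.hom ≫ (ρ_ A).hom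
  have hψ : B ◁ ψ ≫ ev P = θ.hom := by
    have h := (tensorLeftHomEquiv Z A B (𝟙_ C)).symm_apply_apply θ.hom
    have h2 : (tensorLeftHomEquiv Z A B (𝟙_ C)).symm (ψ ≫ (ρ_ A).inv) = θ.hom := by
      rw [← h]; simp [ψ]
    rw [← h2]
    simp only [tensorLeftHomEquiv, Equiv.coe_fn_symm_mk]
    simp [unitors_equal]
  have hne : ψ ≠ 0 := by
    intro h0
    rw [h0] at hψ
    have h1 : θ.hom = 0 := by rw [← hψ]; simp
    apply hI
    rw [← θ.inv_hom_id, h1, comp_zero]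
  have : Epi ψ := epi_of_nonzero_to_simple hne
  have : Epi (B ◁ ψ) := by
    have := (tensorLeft B).preservesEpimorphisms_of_adjunction (tensorLeftAdjunction A B)
    exact (tensorLeft B).map_epi ψ
  have : IsIso (B ◁ ψ ≫ ev P) := by rw [hψ]; infer_instance
  have : Mono (B ◁ ψ) := mono_of_mono (B ◁ ψ) (ev P)
  have : IsIso (B ◁ ψ) := isIso_of_mono_of_epi _
  exact IsIso.of_isIso_comp_left (B ◁ ψ) (ev P)

section Dual

variable {k : Type w} [Field k] {C : Type u} [Category.{v} C] [Abelian C] [Linear k C]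
  [MonoidalCategory C] [MonoidalPreadditive C] [MonoidalLinear k C] [Sovereign C]

theorem IsScalar.dual {X : C} (hX : IsScalar k X) : IsScalar k (dual X) :=
  isScalar_of_exactPairing (rightPairing X) hX

/-- The class of the dual object. -/
def ScalarClass.dual (g : ScalarClass k C) : ScalarClass k C :=
  Quotient.liftOn g (fun X => ScalarClass.mk k (Sovereign.dual X.1) X.2.dual)
    (fun _ _ ⟨i⟩ => (ScalarClass.mk_eq_mk _ _).2 (dual_iso i))

variable (k C) in
/-- The class of the unit object. -/
def ScalarClass.unit [FinitelySemisimple k C] : ScalarClass k C :=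
  ScalarClass.mk k (𝟙_ C) FinitelySemisimple.isScalar_unit

variable [GroupCategory k C]

theorem dual_tensor_iso {X : C} (hX : IsScalar k X) : Nonempty (Sovereign.dual X ⊗ X ≅ 𝟙_ C) := by
  obtain ⟨Z, ⟨θ⟩⟩ := GroupCategory.isInvertible_of_isScalar _ hX.dual
  have := isIso_ev (rightPairing X) hX θ
  exact ⟨asIso (ev (rightPairing X))⟩

theorem tensor_dual_iso {X : C} (hX : IsScalar k X) : Nonempty (X ⊗ Sovereign.dual X ≅ 𝟙_ C) := by
  obtain ⟨Z, ⟨θ⟩⟩ := GroupCategory.isInvertible_of_isScalar _ hX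
  have := isIso_ev (leftPairing X) hX.dual θ
  exact ⟨asIso (ev (leftPairing X))⟩

theorem IsScalar.tensor {X Y : C} (hX : IsScalar k X) (hY : IsScalar k Y) :
    IsScalar k (X ⊗ Y) := by
  obtain ⟨θ⟩ := tensor_dual_iso hY
  rw [isScalar_iff_finrank] at hX ⊢
  rw [← hX]
  have e1 := bendRight k X Y (Sovereign.dual Y) (X ⊗ Y) (rightPairing Y)
  have e2 := Linear.homCongr k (Iso.refl X)
    (α_ X Y (Sovereign.dual Y) ≪≫ whiskerLeftIso X θ ≪≫ ρ_ X)
  exact (e1.trans e2).finrank_eq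

variable (k C) in
/-- The underlying group `Λ_C` of a Group category: the product is given by the tensor product,
the inverse by the dual. -/
instance : Group (ScalarClass k C) where
  mul g h := Quotient.liftOn₂ g h
    (fun X Y => ScalarClass.mk k (X.1 ⊗ Y.1) (X.2.tensor Y.2))
    (fun _ _ _ _ ⟨i⟩ ⟨j⟩ => (ScalarClass.mk_eq_mk _ _).2 ⟨i ⊗ᵢ j⟩)
  one := ScalarClass.unit k C
  inv := ScalarClass.dual
  mul_assoc a b c := by
    induction a using Quotient.inductionOn
    induction b using Quotient.inductionOn
    induction c using Quotient.inductionOn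
    exact (ScalarClass.mk_eq_mk _ _).2 ⟨α_ _ _ _⟩
  one_mul a := by
    induction a using Quotient.inductionOn
    exact (ScalarClass.mk_eq_mk _ _).2 ⟨λ_ _⟩
  mul_one a := by
    induction a using Quotient.inductionOn
    exact (ScalarClass.mk_eq_mk _ _).2 ⟨ρ_ _⟩
  inv_mul_cancel a := by
    induction a using Quotient.inductionOn with | _ X
    exact (ScalarClass.mk_eq_mk _ _).2 (dual_tensor_iso X.2)

end Dual

/-! ## The 6j-symbols -/

section SixJ

variable (k : Type w) [Field k] (C : Type u) [Category.{v} C] [Abelian C] [Linear k C]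

/-- A choice of a representative `X_g` of every isomorphism class `g` of scalar objects. -/
structure Representatives where
  obj : ScalarClass k C → C
  isScalar : ∀ g, IsScalar k (obj g)
  mk_obj : ∀ g, ScalarClass.mk k (obj g) (isScalar g) = g

variable {k C}

theorem Representatives.nonempty_iso (R : Representatives k C) {X : C} (hX : IsScalar k X) :
    Nonempty (X ≅ R.obj (ScalarClass.mk k X hX)) :=
  (ScalarClass.mk_eq_mk hX (R.isScalar _)).1 (R.mk_obj _).symm

/-- A (chosen) isomorphism from a scalar object to the representative of its class. -/
def Representatives.iso (R : Representatives k C) {X : C} (hX : IsScalar k X) :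
    X ≅ R.obj (ScalarClass.mk k X hX) :=
  (R.nonempty_iso hX).some

variable [MonoidalCategory C] [MonoidalPreadditive C] [MonoidalLinear k C]

variable (k) in
/-- `Hom(a, e ⊗ d) ⊗ Hom(e, Y) ⟶ Hom(a, Y ⊗ d)`, `v ⊗ w ↦ (w ⊗ id_d) v`. -/
def fuseLeft (a e d Y : C) : (a ⟶ e ⊗ d) ⊗[k] (e ⟶ Y) →ₗ[k] (a ⟶ Y ⊗ d) :=
  TensorProduct.lift (LinearMap.mk₂ k (fun v w => v ≫ w ▷ d)
    (fun _ _ _ => by simp) (fun _ _ _ => by simp) (fun _ _ _ => by simp) (fun _ _ _ => by simp))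

variable (k) in
/-- `Hom(a, b ⊗ f) ⊗ Hom(f, Y) ⟶ Hom(a, b ⊗ Y)`, `v ⊗ w ↦ (id_b ⊗ w) v`. -/
def fuseRight (a b f Y : C) : (a ⟶ b ⊗ f) ⊗[k] (f ⟶ Y) →ₗ[k] (a ⟶ b ⊗ Y) :=
  TensorProduct.lift (LinearMap.mk₂ k (fun v w => v ≫ b ◁ w)
    (fun _ _ _ => by simp) (fun _ _ _ => by simp) (fun _ _ _ => by simp) (fun _ _ _ => by simp))

instance : DecidableEq (ScalarClass k C) := Classical.decEq _

/-- `⨁_f Hom(a, b ⊗ f) ⊗ Hom(f, Y) ⟶ Hom(a, b ⊗ Y)`, `f` running over the chosen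
representatives. -/
def fuseRightSum (R : Representatives k C) (a b Y : C) :
    DirectSum (ScalarClass k C) (fun g => (a ⟶ b ⊗ R.obj g) ⊗[k] (R.obj g ⟶ Y)) →ₗ[k]
      (a ⟶ b ⊗ Y) :=
  DirectSum.toModule k _ _ fun g => fuseRight k a b (R.obj g) Y

variable [FinitelySemisimple k C]

theorem lof_comp_tmul (R : Representatives k C) {a b Y : C} {f g : ScalarClass k C}
    (z : a ⟶ b ⊗ R.obj f) (q : R.obj f ⟶ R.obj g) (i : R.obj g ⟶ Y) :
    DirectSum.lof k (ScalarClass k C) (fun g => (a ⟶ b ⊗ R.obj g) ⊗[k] (R.obj g ⟶ Y)) g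
        ((z ≫ b ◁ q) ⊗ₜ i) =
      DirectSum.lof k (ScalarClass k C) (fun g => (a ⟶ b ⊗ R.obj g) ⊗[k] (R.obj g ⟶ Y)) f
        (z ⊗ₜ (q ≫ i)) := by
  by_cases h : f = g
  · subst h
    obtain ⟨c, rfl⟩ := (R.isScalar f).2 q
    simp [TensorProduct.smul_tmul]
  · have hq : q = 0 := by
      by_contra hne
      have := isIso_of_ne_zero (R.isScalar f) (R.isScalar g) hne
      apply h
      rw [← R.mk_obj f, ← R.mk_obj g]
      exact (ScalarClass.mk_eq_mk _ _).2 ⟨asIso q⟩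
    subst hq
    simp

theorem fuseRightSum_bijective (R : Representatives k C) (a b Y : C) :
    Function.Bijective (fuseRightSum R a b Y) := by
  obtain ⟨n, S, i, p, hS, hY⟩ := exists_decomposition k Y
  let g : Fin n → ScalarClass k C := fun j => ScalarClass.mk k (S j) (hS j)
  let i' : ∀ j, R.obj (g j) ⟶ Y := fun j => (R.iso (hS j)).inv ≫ i j
  let p' : ∀ j, Y ⟶ R.obj (g j) := fun j => p j ≫ (R.iso (hS j)).hom
  have hY' : ∑ j, p' j ≫ i' j = 𝟙 Y := by
    rw [← hY]
    exact Finset.sum_congr rfl fun j _ => by simp [p', i']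
  let inv : (a ⟶ b ⊗ Y) →
      DirectSum (ScalarClass k C) (fun g => (a ⟶ b ⊗ R.obj g) ⊗[k] (R.obj g ⟶ Y)) :=
    fun u => ∑ j, DirectSum.lof k (ScalarClass k C)
      (fun g => (a ⟶ b ⊗ R.obj g) ⊗[k] (R.obj g ⟶ Y)) (g j) ((u ≫ b ◁ p' j) ⊗ₜ i' j)
  have hadd : ∀ u u', inv (u + u') = inv u + inv u' := by
    intro u u'
    simp only [inv, Preadditive.add_comp, TensorProduct.add_tmul, map_add, Finset.sum_add_distrib]
  have hzero : inv 0 = 0 := by simp [inv]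
  refine Function.bijective_iff_has_inverse.2 ⟨inv, ?_, ?_⟩
  · intro t
    induction t using DirectSum.induction_on with
    | zero => simp [hzero]
    | add x y hx hy => rw [map_add, hadd, hx, hy]
    | of f t =>
      change inv (fuseRightSum R a b Y (DirectSum.lof k _ _ f t)) = DirectSum.lof k _ _ f t
      induction t using TensorProduct.induction_on with
      | zero => simp [hzero]
      | add x y hx hy => rw [map_add, map_add, hadd, hx, hy]
      | tmul z w =>
        have h1 : fuseRightSum R a b Y (DirectSum.lof k _ _ f (z ⊗ₜ w)) = z ≫ b ◁ w := by
          simp [fuseRightSum, fuseRight]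
        rw [h1]
        have h2 : ∀ j, (z ≫ b ◁ w) ≫ b ◁ p' j = z ≫ b ◁ (w ≫ p' j) := fun j => by simp
        simp only [inv, h2, lof_comp_tmul]
        rw [← map_sum, ← TensorProduct.tmul_sum]
        simp only [Category.assoc]
        rw [← Preadditive.comp_sum, hY', Category.comp_id]
  · intro u
    simp only [inv, map_sum]
    have h1 : ∀ j, fuseRightSum R a b Y (DirectSum.lof k _ _ (g j) ((u ≫ b ◁ p' j) ⊗ₜ i' j)) =
        u ≫ b ◁ (p' j ≫ i' j) := by
      intro j; simp [fuseRightSum, fuseRight]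
    simp only [h1]
    rw [← Preadditive.comp_sum, ← whiskerLeft_sum, hY']
    simp

/-- The isomorphism `⨁_f Hom(a, b ⊗ f) ⊗ Hom(f, Y) ≅ Hom(a, b ⊗ Y)`. -/
def fuseRightEquiv (R : Representatives k C) (a b Y : C) :
    DirectSum (ScalarClass k C) (fun g => (a ⟶ b ⊗ R.obj g) ⊗[k] (R.obj g ⟶ Y)) ≃ₗ[k]
      (a ⟶ b ⊗ Y) :=
  LinearEquiv.ofBijective (fuseRightSum R a b Y) (fuseRightSum_bijective R a b Y)

/-- The component in `Hom(a, b ⊗ f) ⊗ Hom(f, Y)` of a morphism `a ⟶ b ⊗ Y`, for a scalar object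
`f`. If `f` is not itself one of the representatives, one transports along an isomorphism `θ` from
`f` to the representative of its class; the result does not depend on `θ`. -/
def fuseRightComponent (R : Representatives k C) (a b Y f : C) (hf : IsScalar k f) :
    (a ⟶ b ⊗ Y) →ₗ[k] (a ⟶ b ⊗ f) ⊗[k] (f ⟶ Y) :=
  TensorProduct.map (Linear.rightComp k a (b ◁ (R.iso hf).inv)) (Linear.leftComp k Y (R.iso hf).hom) ∘ₗ
    DirectSum.component k _ _ (ScalarClass.mk k f hf) ∘ₗ
    (fuseRightEquiv R a b Y).symm.toLinearMap

/-- The 6j-symbol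
`{a b c; d e f} : Hom(a, e ⊗ d) ⊗ Hom(e, b ⊗ c) ⟶ Hom(a, b ⊗ f) ⊗ Hom(f, c ⊗ d)`
induced by the associativity constraint `(b ⊗ c) ⊗ d ≅ b ⊗ (c ⊗ d)`. -/
def sixJ (R : Representatives k C) (a b c d e f : C) (hf : IsScalar k f) :
    (a ⟶ e ⊗ d) ⊗[k] (e ⟶ b ⊗ c) →ₗ[k] (a ⟶ b ⊗ f) ⊗[k] (f ⟶ c ⊗ d) :=
  fuseRightComponent R a b (c ⊗ d) f hf ∘ₗ Linear.rightComp k a (α_ b c d).hom ∘ₗ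
    fuseLeft k a e d (b ⊗ c)

variable [Sovereign C]

variable (k) in
/-- The bilinear form `ω(g, f) = tr(g f)` on `Hom(Y, X) × Hom(X, Y)`, as a linear form in `f`. -/
def traceForm {X Y : C} (g : Y ⟶ X) : (X ⟶ Y) →ₗ[k] k := qtrace k X ∘ₗ Linear.rightComp k X g

/-- The adjoint of the 6j-symbol `{a b c; d e f}` with respect to `ω`, evaluated on
`v₀ ⊗ v₁ ⊗ v₂ ⊗ v₃`. -/
def sixJForm (R : Representatives k C) (a b c d e f : C) (hf : IsScalar k f)
    (v₀ : c ⊗ d ⟶ f) (v₁ : a ⟶ e ⊗ d) (v₂ : b ⊗ f ⟶ a) (v₃ : e ⟶ b ⊗ c) : k :=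
  (LinearMap.mul' k k ∘ₗ TensorProduct.map (traceForm k v₂) (traceForm k v₀))
    (sixJ R a b c d e f hf (v₁ ⊗ₜ v₃))

end SixJ

/-! ## Triangulations, orientations, the Dijkgraaf-Witten invariant -/

section Triangulations

/-- The geometric realization of a finite simplicial complex: the points of the standard simplex
on the set of vertices whose support is a simplex. -/
def realization {V : Type*} [Fintype V] (K : AbstractSimplicialComplex V) : Set (V → ℝ) :=
  {x | x ∈ stdSimplex ℝ V ∧ ∃ F ∈ K.faces, (F : Set V) = {v | x v ≠ 0}}

/-- A triangulation of `M` with (finite) set of vertices `V`. -/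
structure Triangulation (V : Type*) [Fintype V] (M : Type*) [TopologicalSpace M] where
  complex : AbstractSimplicialComplex V
  homeo : realization complex ≃ₜ M

/-- `p 0, …, p (n-1)` are the vertices, numbered without repetition, of a simplex of `K`. -/
def IsSimplex {V : Type*} (K : AbstractSimplicialComplex V) {n : ℕ} (p : Fin n → V) : Prop :=
  Function.Injective p ∧ ∃ F ∈ K.faces, (F : Set V) = Set.range p

open scoped Classical in
/-- An orientation of a triangulated closed 3-manifold: every numbering of the vertices of a
3-simplex is declared to be positive (`1`) or negative (`-1`), a permutation changes this sign by
its signature, and the oriented 3-simplices form a cycle. As a 2-simplex `abc` of a closed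
3-manifold is a face of exactly two 3-simplices `abcd` and `abcd'`, the last condition says that
these two induce opposite orientations on `abc`. -/
structure SimplicialOrientation {V : Type*} [Fintype V] (K : AbstractSimplicialComplex V) where
  sign : (Fin 4 → V) → ℤˣ
  sign_perm : ∀ p, IsSimplex K p → ∀ σ : Equiv.Perm (Fin 4),
    sign (p ∘ σ) = Equiv.Perm.sign σ * sign p
  cycle : ∀ a b c, IsSimplex K ![a, b, c] →
    ∑ d with IsSimplex K ![a, b, c, d], (sign ![a, b, c, d] : ℤ) = 0

variable {V : Type*} [LinearOrder V]

/-- The edges of `K`, with their vertices in ascending order. -/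
def Edge (K : AbstractSimplicialComplex V) : Type _ :=
  {x : V × V // x.1 < x.2 ∧ IsSimplex K ![x.1, x.2]}

/-- The 2-simplices of `K`, with their vertices in ascending order. -/
def Face (K : AbstractSimplicialComplex V) : Type _ :=
  {x : V × V × V // x.1 < x.2.1 ∧ x.2.1 < x.2.2 ∧ IsSimplex K ![x.1, x.2.1, x.2.2]}

/-- The 3-simplices of `K`, with their vertices in ascending order. -/
def Tetra (K : AbstractSimplicialComplex V) : Type _ :=
  {x : Fin 4 → V // StrictMono x ∧ IsSimplex K x}

instance [Fintype V] (K : AbstractSimplicialComplex V) : Finite (Edge K) := Subtype.finite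
instance [Fintype V] (K : AbstractSimplicialComplex V) : Finite (Face K) := Subtype.finite
instance [Fintype V] (K : AbstractSimplicialComplex V) : Finite (Tetra K) := Subtype.finite
instance [Fintype V] (K : AbstractSimplicialComplex V) : Fintype (Edge K) := Fintype.ofFinite _
instance [Fintype V] (K : AbstractSimplicialComplex V) : Fintype (Face K) := Fintype.ofFinite _
instance [Fintype V] (K : AbstractSimplicialComplex V) : Fintype (Tetra K) := Fintype.ofFinite _
instance [Fintype V] (K : AbstractSimplicialComplex V) : DecidableEq (Face K) := Classical.decEq _

/-- The colors of `K` with values in the group `G`. A color is a function on oriented edges; it is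
written as a function of two vertices which takes the value `1` on the pairs of vertices which do
not span an edge. -/
def Color (G : Type*) [Group G] (K : AbstractSimplicialComplex V) : Type _ :=
  {γ : V → V → G // (∀ a b, ¬ IsSimplex K ![a, b] → γ a b = 1) ∧
    (∀ a b, IsSimplex K ![a, b] → γ b a = (γ a b)⁻¹) ∧
    (∀ a b c, IsSimplex K ![a, b, c] → γ a b * γ b c * γ c a = 1)}

instance (G : Type*) [Group G] [Finite G] [Fintype V] (K : AbstractSimplicialComplex V) :
    Finite (Color G K) := Subtype.finite
instance (G : Type*) [Group G] [Finite G] [Fintype V] (K : AbstractSimplicialComplex V) :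
    Fintype (Color G K) := Fintype.ofFinite _

/-- The 3-cocycle condition, for a function `G³ → k^*` (with trivial action of `G` on `k^*`). -/
def IsCocycle {k : Type*} [Field k] {G : Type*} [Group G] (α : G → G → G → kˣ) : Prop :=
  ∀ g h i j, α g h (i * j) * α (g * h) i j = α h i j * α g (h * i) j * α g h i

/-- The Dijkgraaf-Witten invariant of a triangulated closed oriented 3-manifold:
`|G|^{-n₀} ∑_γ ∏_Δ α(γ(01), γ(12), γ(23))^{ε_Δ}`, where `0 < 1 < 2 < 3` are the vertices of the
3-simplex `Δ` in ascending order, and `ε_Δ = ±1` compares this numbering with the orientation. -/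
def dijkgraafWitten {k : Type*} [Field k] {G : Type*} [Group G] [Finite G] (α : G → G → G → kˣ)
    [Fintype V] {M : Type*} [TopologicalSpace M] (T : Triangulation V M)
    (o : SimplicialOrientation T.complex) : k :=
  ((Nat.card G : k) ^ Fintype.card V)⁻¹ * ∑ γ : Color G T.complex, ∏ Δ : Tetra T.complex,
    (((α (γ.1 (Δ.1 0) (Δ.1 1)) (γ.1 (Δ.1 1) (Δ.1 2)) (γ.1 (Δ.1 2) (Δ.1 3))) ^
      ((o.sign Δ.1 : ℤˣ) : ℤ) : kˣ) : k)

end Triangulations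

/-! ## The Turaev-Viro invariant -/

section TuraevViro

variable {V : Type*}

/-- The data attached to a colored complex: an object `O(ij)` for every oriented edge `ij`, such
that `O(ij)` and `O(ji)` are dual to each other, in both ways. -/
structure EdgeObjects (V : Type*) (k : Type w) [Field k] (C : Type u) [Category.{v} C] [Abelian C]
    [Linear k C] [MonoidalCategory C] where
  obj : V → V → C
  isScalar : ∀ i j, IsScalar k (obj i j)
  pairing : ∀ {i j}, i ≠ j → ExactPairing (obj i j) (obj j i)

variable {k : Type w} [Field k] {C : Type u} [Category.{v} C] [Abelian C] [Linear k C]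
  [MonoidalCategory C]

/-- `X` for a positively oriented edge (`b = true`), `Y^∨` for a negatively oriented one. -/
def orientedObj [Sovereign C] (X Y : C) : Bool → C
  | true => X
  | false => dual Y

theorem orientedObj_isScalar [MonoidalPreadditive C] [MonoidalLinear k C] [Sovereign C] {X Y : C}
    (hX : IsScalar k X) (hY : IsScalar k Y) : ∀ b, IsScalar k (orientedObj X Y b)
  | true => hX
  | false => hY.dual

/-- The two dualities between `X` and `X^∨`. -/
@[reducible] def orientedPairing [Sovereign C] (X Y : C) :
    ∀ b b' : Bool, b' = !b → ExactPairing (orientedObj X Y b) (orientedObj Y X b')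
  | true, false, _ => rightPairing X
  | false, true, _ => leftPairing Y

variable [MonoidalPreadditive C] [MonoidalLinear k C]

/-- The objects of a colored complex with ordered vertices: `O(ij) = X_{γ(ij)}` and
`O(ji) = X_{γ(ij)}^∨` if `i < j`. -/
def edgeObjects [Sovereign C] [LinearOrder V] (R : Representatives k C)
    (γ : V → V → ScalarClass k C) : EdgeObjects V k C where
  obj i j := orientedObj (R.obj (γ i j)) (R.obj (γ j i)) (decide (i < j))
  isScalar i j := orientedObj_isScalar (R.isScalar _) (R.isScalar _) _
  pairing {i j} h := orientedPairing (R.obj (γ i j)) (R.obj (γ j i)) (decide (i < j))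
    (decide (j < i)) (by rcases lt_or_gt_of_ne h with h | h <;> simp [h, h.le, not_lt])

namespace EdgeObjects

variable (E : EdgeObjects V k C)

/-- The vector space `V(abc) = Hom(I, O(ab) ⊗ O(bc) ⊗ O(ca))` of an oriented 2-simplex. -/
abbrev space (a b c : V) : Type v := 𝟙_ C ⟶ (E.obj a b ⊗ E.obj b c) ⊗ E.obj c a

/-- The isomorphism `V(abc) ≅ Hom(O(ac), O(ab) ⊗ O(bc))` given by duality. -/
def outHom {a b c : V} (hac : a ≠ c) : E.space a b c ≃ₗ[k] (E.obj a c ⟶ E.obj a b ⊗ E.obj b c) :=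
  (bendRight k (𝟙_ C) (E.obj a c) (E.obj c a) (E.obj a b ⊗ E.obj b c) (E.pairing hac)).symm ≪≫ₗ
    Linear.homCongr k (λ_ _) (Iso.refl _)

/-- The isomorphism `V(acb) ≅ Hom(O(ab) ⊗ O(bc), O(ac))` given by duality. -/
def inHom {a b c : V} (hab : a ≠ b) (hbc : b ≠ c) :
    E.space a c b ≃ₗ[k] (E.obj a b ⊗ E.obj b c ⟶ E.obj a c) :=
  (bendRight k (𝟙_ C) (E.obj a b) (E.obj b a) (E.obj a c ⊗ E.obj c b) (E.pairing hab)).symm ≪≫ₗ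
    (bendRight k (𝟙_ C ⊗ E.obj a b) (E.obj b c) (E.obj c b) (E.obj a c) (E.pairing hbc)).symm ≪≫ₗ
    Linear.homCongr k (whiskerRightIso (λ_ _) _) (Iso.refl _)

/-- The isomorphism `V(abc) ≅ V(bca)`,
`f ↦ (ε ⊗ id) (id ⊗ f ⊗ id) h` with `h : I ⟶ O(ba) ⊗ O(ab)` and `ε : O(ba) ⊗ O(ab) ⟶ I`. -/
def rotate {a b c : V} (hab : a ≠ b) (f : E.space a b c) : E.space b c a :=
  coev (E.pairing hab.symm) ≫ E.obj b a ◁ ((λ_ (E.obj a b)).inv ≫ f ▷ E.obj a b) ⊗≫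
    ev (E.pairing hab) ▷ ((E.obj b c ⊗ E.obj c a) ⊗ E.obj a b) ≫ (λ_ _).hom

/-- The isomorphism `V(acb) ≅ Hom(O(ab) ⊗ O(bc) ⊗ O(ca), I)`, `g ↦ g^∨`. -/
def transpose {a b c : V} (hab : a ≠ b) (hbc : b ≠ c) (hca : c ≠ a) :
    E.space a c b ≃ₗ[k] ((E.obj a b ⊗ E.obj b c) ⊗ E.obj c a ⟶ 𝟙_ C) :=
  E.inHom hab hbc ≪≫ₗ Linear.homCongr k (Iso.refl _) (λ_ _).symm ≪≫ₗ
    (bendRight k (E.obj a b ⊗ E.obj b c) (E.obj c a) (E.obj a c) (𝟙_ C) (E.pairing hca)).symm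

variable [FinitelySemisimple k C]

/-- The contraction `V(acb) ⊗ V(abc) ⟶ k`, `g ⊗ f ↦ g^∨ f`. -/
def contr {a b c : V} (hab : a ≠ b) (hbc : b ≠ c) (hca : c ≠ a) :
    E.space a c b →ₗ[k] E.space a b c →ₗ[k] k :=
  unitPairing k _ ∘ₗ (E.transpose hab hbc hca).toLinearMap

/-- The contraction is non-degenerate: it identifies `V(acb)` with the dual of `V(abc)`. -/
def contrEquiv {a b c : V} (hab : a ≠ b) (hbc : b ≠ c) (hca : c ≠ a) :
    E.space a c b ≃ₗ[k] Module.Dual k (E.space a b c) :=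
  E.transpose hab hbc hca ≪≫ₗ (unitPairing k _).toPerfPair

theorem contrEquiv_apply {a b c : V} (hab : a ≠ b) (hbc : b ≠ c) (hca : c ≠ a)
    (g : E.space a c b) (f : E.space a b c) :
    E.contrEquiv hab hbc hca g f = E.contr hab hbc hca g f := rfl

instance (a b c : V) : Module.Finite k (E.space a b c) := finite_hom k _ _

/-- A basis of `V(abc)`. -/
def basis (a b c : V) : Module.Basis (Fin (Module.finrank k (E.space a b c))) k (E.space a b c) :=
  Module.finBasis k _

/-- The basis of `V(acb)` dual to `basis a b c` with respect to the contraction. -/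
def dualBasis {a b c : V} (hab : a ≠ b) (hbc : b ≠ c) (hca : c ≠ a)
    (m : Fin (Module.finrank k (E.space a b c))) : E.space a c b :=
  (E.contrEquiv hab hbc hca).symm ((E.basis a b c).coord m)

/-- The linear form `L((0123), γ)` on `V(132) ⊗ V(023) ⊗ V(031) ⊗ V(012)`, evaluated on
`v₀ ⊗ v₁ ⊗ v₂ ⊗ v₃`, for a numbering `p` of the vertices of a 3-simplex. -/
def tetraForm [Sovereign C] (R : Representatives k C) (p : Fin 4 → V) (hp : Function.Injective p)
    (v₀ : E.space (p 1) (p 3) (p 2)) (v₁ : E.space (p 0) (p 2) (p 3))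
    (v₂ : E.space (p 0) (p 3) (p 1)) (v₃ : E.space (p 0) (p 1) (p 2)) : k :=
  (qdim k (E.obj (p 1) (p 3)))⁻¹ *
    sixJForm R (E.obj (p 0) (p 3)) (E.obj (p 0) (p 1)) (E.obj (p 1) (p 2)) (E.obj (p 2) (p 3))
      (E.obj (p 0) (p 2)) (E.obj (p 1) (p 3)) (E.isScalar _ _)
      (E.inHom (hp.ne (by decide)) (hp.ne (by decide)) v₀)
      (E.outHom (hp.ne (by decide)) v₁)
      (E.inHom (hp.ne (by decide)) (hp.ne (by decide)) v₂)
      (E.outHom (hp.ne (by decide)) v₃)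

variable [LinearOrder V] (K : AbstractSimplicialComplex V)

/-- The indices of a term of the contraction: for every 2-simplex, with ascending vertices
`a < b < c`, the index of a vector of the basis of `V(abc)` (and of the dual basis of
`V(acb)`). -/
abbrev State : Type _ :=
  ∀ F : Face K, Fin (Module.finrank k (E.space F.1.1 F.1.2.1 F.1.2.2))

variable {K}

open scoped Classical in
/-- The vector of `V(xyz)` given by a state, for an oriented 2-simplex `xyz` whose smallest vertex
is `x`: a vector of the chosen basis if `x < y < z`, of the dual basis if `x < z < y`. -/
def baseVec (s : E.State K) (x y z : V) : E.space x y z :=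
  if h : x < y ∧ y < z ∧ IsSimplex K ![x, y, z] then E.basis x y z (s ⟨(x, y, z), h⟩)
  else if h : x < z ∧ z < y ∧ IsSimplex K ![x, z, y] then
    E.dualBasis h.1.ne h.2.1.ne (h.1.trans h.2.1).ne' (s ⟨(x, z, y), h⟩)
  else 0

/-- The vector of `V(xyz)` given by a state, for any oriented 2-simplex `xyz`: the vector of
`baseVec`, carried to the right starting point by the rotations `V(abc) ≅ V(bca)`. -/
def faceVec (s : E.State K) {x y z : V} (hyz : y ≠ z) (hzx : z ≠ x) : E.space x y z :=
  if x < y ∧ x < z then E.baseVec s x y z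
  else if z < x ∧ z < y then E.rotate hzx (E.baseVec s z x y)
  else E.rotate hzx (E.rotate hyz (E.baseVec s y z x))

end EdgeObjects

/-- A numbering of the vertices of a 3-simplex which is positive for the given orientation: the
ascending numbering `(0123)` if it is positive, and `(0213)` otherwise. -/
def positiveNumbering [LinearOrder V] [Fintype V] {K : AbstractSimplicialComplex V}
    (o : SimplicialOrientation K) (Δ : Tetra K) : Fin 4 → V :=
  if o.sign Δ.1 = 1 then Δ.1 else Δ.1 ∘ Equiv.swap (1 : Fin 4) 2

theorem positiveNumbering_injective [LinearOrder V] [Fintype V] {K : AbstractSimplicialComplex V}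
    (o : SimplicialOrientation K) (Δ : Tetra K) : Function.Injective (positiveNumbering o Δ) := by
  unfold positiveNumbering
  split_ifs
  · exact Δ.2.1.injective
  · exact Δ.2.1.injective.comp (Equiv.injective _)

theorem sign_positiveNumbering [LinearOrder V] [Fintype V] {K : AbstractSimplicialComplex V}
    (o : SimplicialOrientation K) (Δ : Tetra K) : o.sign (positiveNumbering o Δ) = 1 := by
  unfold positiveNumbering
  split_ifs with h
  · exact h
  · rw [o.sign_perm _ Δ.2.2, Equiv.Perm.sign_swap (by decide),
      (Int.units_eq_one_or _).resolve_left h]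
    rfl

variable [FinitelySemisimple k C] [Sovereign C]

/-- The number `Z(M, γ)`: the tensor product of the forms `L(Δ, γ)` over all 3-simplices, numbered
according to the orientation, contracted along all 2-simplices. The contraction along a 2-simplex
`abc`, at which `V(abc)^*` and `V(acb)^*` are contracted, is the sum over a basis of `V(abc)` and
the dual basis of `V(acb)`. -/
def stateSum [LinearOrder V] [Fintype V] {K : AbstractSimplicialComplex V}
    (R : Representatives k C) (o : SimplicialOrientation K) (γ : V → V → ScalarClass k C) : k :=
  ∑ s : (edgeObjects R γ).State K, ∏ Δ : Tetra K,
    have hp := positiveNumbering_injective o Δ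
    (edgeObjects R γ).tetraForm R (positiveNumbering o Δ) hp
      ((edgeObjects R γ).faceVec s (hp.ne (by decide)) (hp.ne (by decide)))
      ((edgeObjects R γ).faceVec s (hp.ne (by decide)) (hp.ne (by decide)))
      ((edgeObjects R γ).faceVec s (hp.ne (by decide)) (hp.ne (by decide)))
      ((edgeObjects R γ).faceVec s (hp.ne (by decide)) (hp.ne (by decide)))

/-- The Turaev-Viro colors of `K`: functions `γ` from the oriented edges to `Λ_C` such that
`γ(ē) = γ(e)^∨`; as for `Color`, the value on pairs of vertices which do not span an edge is fixed
(to be the class of the unit). -/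
def TVColor (k : Type w) [Field k] (C : Type u) [Category.{v} C] [Abelian C] [Linear k C]
    [MonoidalCategory C] [MonoidalPreadditive C] [MonoidalLinear k C] [Sovereign C]
    [FinitelySemisimple k C] (K : AbstractSimplicialComplex V) : Type _ :=
  {γ : V → V → ScalarClass k C // (∀ a b, ¬ IsSimplex K ![a, b] → γ a b = ScalarClass.unit k C) ∧
    (∀ a b, IsSimplex K ![a, b] → γ b a = (γ a b).dual)}

instance [Fintype V] (K : AbstractSimplicialComplex V) : Finite (TVColor k C K) := Subtype.finite
instance [Fintype V] (K : AbstractSimplicialComplex V) : Fintype (TVColor k C K) :=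
  Fintype.ofFinite _

/-- The Turaev-Viro invariant of a triangulated closed oriented 3-manifold:
`(∑_X dim(X)²)^{-n₀} ∑_γ (∏_e dim(γ(e))) Z(M, γ)`. -/
def turaevViro [LinearOrder V] [Fintype V] (R : Representatives k C) {M : Type*}
    [TopologicalSpace M] (T : Triangulation V M) (o : SimplicialOrientation T.complex) : k :=
  ((∑ g : ScalarClass k C, qdim k (R.obj g) ^ 2) ^ Fintype.card V)⁻¹ *
    ∑ γ : TVColor k C T.complex,
      (∏ e : Edge T.complex, qdim k (R.obj (γ.1 e.1.1 e.1.2))) * stateSum R o γ.1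

end TuraevViro

/-! ## The associativity constraint of a Group category -/

/-- `α : Λ_C³ → k^*` is the associativity constraint of the Group category `C`: for some choice of
bases `φ(g, h)` of the (one-dimensional) spaces `Hom(X_{gh}, X_g ⊗ X_h)`, one has
`α(g, h, i) (id ⊗ φ(h, i)) φ(g, hi) = a (φ(g, h) ⊗ id) φ(gh, i)`,
where `a` is the associativity isomorphism of `C`. -/
def IsAssociativityConstraint {k : Type w} [Field k] {C : Type u} [Category.{v} C] [Abelian C]
    [Linear k C] [MonoidalCategory C] [MonoidalPreadditive C] [MonoidalLinear k C] [Sovereign C]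
    [GroupCategory k C] (R : Representatives k C)
    (α : ScalarClass k C → ScalarClass k C → ScalarClass k C → kˣ) : Prop :=
  ∃ φ : ∀ g h : ScalarClass k C, R.obj (g * h) ⟶ R.obj g ⊗ R.obj h,
    (∀ g h, φ g h ≠ 0) ∧
    ∀ g h i, (α g h i : k) • (φ g (h * i) ≫ R.obj g ◁ φ h i) =
      eqToHom (by rw [mul_assoc]) ≫ φ (g * h) i ≫ φ g h ▷ R.obj i ≫ (α_ _ _ _).hom

end DWTV
end

open DWTV

/-! When all dimensions are 1, both invariants carry the factor `|G|^{-n₀}` and every edge has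
weight 1, so only the sums over colors need comparing. Write `O(ab)` for the object on the edge
`ab`.

By Schur's lemma the space `V(abc) ≅ Hom(O(ac), O(ab) ⊗ O(bc))` vanishes unless `γ(ac) =
γ(ab)γ(bc)`. A Turaev-Viro color that is not flat has no states and contributes 0
(`stateSum_eq_zero`); the flat ones are exactly the Dijkgraaf-Witten colors.

For a flat color every `V(abc)` is a line, so there is a single state. The basis vector of `V(abc)`
corresponds to `u(abc) φ` for a unit `u(abc)`, and the dual vector to `u(abc)⁻¹ φ⁻¹`, because the
contraction is the trace and `dim = 1` (`exists_unit_basis`). By the associativity relation a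
positive 3-simplex (0123) gives `α · u(012) u(023) u(013)⁻¹ u(123)⁻¹`. A negative one, numbered
(0213) in the Turaev-Viro form, has one face vector rotated; undoing the rotation reverses the
composite, which gives the inverse of the same expression (`tetraForm_faceVec_of_lt`,
`tetraForm_faceVec_of_gt`).

The factors `u` form a coboundary, and a coboundary evaluates to 1 on the fundamental cycle
(`prod_coboundary`). What remains is `∏ α^ε`, the Dijkgraaf-Witten weight (`stateSum_eq_prod`). -/

noncomputable section

namespace DWTV

/-! ### Evaluation of the 6j-symbol on invertible morphisms. -/

section SixJSymbols

variable {k : Type w} [Field k] {C : Type u} [Category.{v} C] [Abelian C] [Linear k C]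
  [MonoidalCategory C] [MonoidalPreadditive C] [MonoidalLinear k C]

/-- A composite through `f` lies entirely in the summand of the class of `f`; the chosen isomorphism
to the representative enters once in each direction and cancels. -/
theorem fuseRightComponent_comp_whiskerLeft [FinitelySemisimple k C] (R : Representatives k C)
    {a b Y f : C} (hf : IsScalar k f) (z : a ⟶ b ⊗ f) (w : f ⟶ Y) :
    fuseRightComponent R a b Y f hf (z ≫ b ◁ w) = z ⊗ₜ w := by
  have h : (fuseRightEquiv R a b Y).symm (z ≫ b ◁ w) =
      DirectSum.lof k (ScalarClass k C) (fun g => (a ⟶ b ⊗ R.obj g) ⊗[k] (R.obj g ⟶ Y))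
        (ScalarClass.mk k f hf) ((z ≫ b ◁ (R.iso hf).hom) ⊗ₜ ((R.iso hf).inv ≫ w)) := by
    rw [LinearEquiv.symm_apply_eq]
    simp [fuseRightEquiv, fuseRightSum, fuseRight, ← whiskerLeft_comp_assoc]
  simp only [fuseRightComponent, LinearMap.comp_apply, LinearEquiv.coe_coe, h,
    DirectSum.component.lof_self, TensorProduct.map_tmul]
  simp [← whiskerLeft_comp]

/-- The 6j-symbol form is read off from the composite of the four given morphisms. -/
theorem sixJForm_eq [Sovereign C] [GroupCategory k C] (R : Representatives k C) {a b c d e f : C}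
    (ha : IsScalar k a) (hb : IsScalar k b) (hc : IsScalar k c) (hd : IsScalar k d)
    (hf : IsScalar k f) (v₀ : c ⊗ d ⟶ f) (v₁ : a ⟶ e ⊗ d) (v₂ : b ⊗ f ⟶ a) (v₃ : e ⟶ b ⊗ c)
    {t : k} (ht : t ≠ 0)
    (h : v₁ ≫ v₃ ▷ d ≫ (α_ b c d).hom ≫ b ◁ v₀ ≫ v₂ = t • 𝟙 a) :
    sixJForm R a b c d e f hf v₀ v₁ v₂ v₃ = t * (qdim k a * qdim k f) := by
  -- Since `t ≠ 0`, neither `v₀` nor `v₂` is zero; both run between simple objects and are therefore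
  -- invertible. Their inverses then turn `h` into a factorization through `f`, whose component is a
  -- pure tensor.
  have hne : t • 𝟙 a ≠ 0 := smul_ne_zero ht ha.id_ne_zero
  have h₀ : v₀ ≠ 0 := by
    rintro rfl
    exact hne (by rw [← h]; simp)
  have h₂ : v₂ ≠ 0 := by
    rintro rfl
    exact hne (by rw [← h]; simp)
  have := isIso_of_ne_zero (hc.tensor hd) hf h₀
  have := isIso_of_ne_zero (hb.tensor hf) ha h₂
  have key : v₁ ≫ v₃ ▷ d ≫ (α_ b c d).hom = t • (inv v₂ ≫ b ◁ inv v₀) := by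
    rw [← cancel_mono (b ◁ v₀ ≫ v₂)]
    simpa [← whiskerLeft_comp_assoc] using h
  have h6 : sixJ R a b c d e f hf (v₁ ⊗ₜ v₃) = t • (inv v₂ ⊗ₜ inv v₀) := by
    simp only [sixJ, LinearMap.comp_apply]
    have : (Linear.rightComp k a (α_ b c d).hom) (fuseLeft k a e d (b ⊗ c) (v₁ ⊗ₜ v₃)) =
        t • (inv v₂ ≫ b ◁ inv v₀) := by
      rw [← key]; simp [fuseLeft]
    rw [this, map_smul, fuseRightComponent_comp_whiskerLeft]
  simp [sixJForm, h6, traceForm, qdim]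

end SixJSymbols

/-! ### Bending and rotating the vectors of an oriented 2-simplex. -/

section Tensor

variable {k : Type w} [Field k] {C : Type u} [Category.{v} C] [Abelian C] [Linear k C]
  [MonoidalCategory C] [MonoidalPreadditive C] [MonoidalLinear k C]

namespace EdgeObjects

variable {V : Type*} (E : EdgeObjects V k C)

theorem outHom_eq {a b c : V} (hac : a ≠ c) (f : E.space a b c) :
    E.outHom hac f = (λ_ _).inv ≫ f ▷ E.obj a c ≫ (α_ _ _ _).hom ≫
      (E.obj a b ⊗ E.obj b c) ◁ ev (E.pairing hac) ≫ (ρ_ _).hom := by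
  simp [outHom, bendRight, tensorRightHomEquiv, Linear.homCongr_apply]

/-- The snake identity: bending with the coevaluation inverts `outHom`. To compute `outHom` of a
vector it thus suffices to write the vector in this bent form. -/
theorem outHom_coev {a b c : V} (hac : a ≠ c) (A : E.obj a c ⟶ E.obj a b ⊗ E.obj b c) :
    E.outHom hac (coev (E.pairing hac) ≫ A ▷ E.obj c a) = A := by
  rw [← LinearEquiv.eq_symm_apply]
  have h : (Linear.homCongr k (λ_ (E.obj a c)) (Iso.refl (E.obj a b ⊗ E.obj b c))).symm A =
      (λ_ _).hom ≫ A := by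
    rw [LinearEquiv.symm_apply_eq]
    simp [Linear.homCongr_apply]
  simp [outHom, bendRight, tensorRightHomEquiv, h, unitors_equal]

theorem coev_outHom {a b c : V} (hac : a ≠ c) (f : E.space a b c) :
    coev (E.pairing hac) ≫ E.outHom hac f ▷ E.obj c a = f :=
  (E.outHom hac).injective (E.outHom_coev hac _)

/-- The two ways of bending a vector of `V(acb)`. -/
theorem inHom_eq {a b c : V} (hab : a ≠ b) (hbc : b ≠ c) (g : E.space a c b) :
    E.inHom hab hbc g = E.outHom hab g ▷ E.obj b c ≫ (α_ _ _ _).hom ≫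
      E.obj a c ◁ ev (E.pairing hbc) ≫ (ρ_ _).hom := by
  simp [inHom, outHom, bendRight, tensorRightHomEquiv, Linear.homCongr_apply]

theorem outHom_rotate {a b c : V} (hab : a ≠ b) (f : E.space a b c) :
    E.outHom hab.symm (E.rotate hab f) = (ρ_ _).inv ≫ E.obj b a ◁ (f ≫ (α_ _ _ _).hom) ≫
      (α_ _ _ _).inv ≫ ev (E.pairing hab) ▷ (E.obj b c ⊗ E.obj c a) ≫ (λ_ _).hom := by
  -- Up to coherence, `rotate` is already a coevaluation followed by a whiskered morphism.
  have : E.rotate hab f = coev (E.pairing hab.symm) ≫ ((ρ_ _).inv ≫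
      E.obj b a ◁ (f ≫ (α_ _ _ _).hom) ≫ (α_ _ _ _).inv ≫
      ev (E.pairing hab) ▷ (E.obj b c ⊗ E.obj c a) ≫ (λ_ _).hom) ▷ E.obj a b := by
    rw [rotate]
    monoidal
  rw [this, outHom_coev]

/-- The evaluations that close off `O(ab)` and `O(ca)` act on disjoint tensor factors, so they
commute. Hence rotating and then bending inwards amounts to bending the first output leg of `outHom
f`. -/
theorem inHom_rotate {a b c : V} (hab : a ≠ b) (hac : a ≠ c) (f : E.space a b c) :
    E.inHom hab.symm hac (E.rotate hab f) = E.obj b a ◁ E.outHom hac f ≫ (α_ _ _ _).inv ≫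
      ev (E.pairing hab) ▷ E.obj b c ≫ (λ_ _).hom := by
  rw [inHom_eq, outHom_rotate, outHom_eq]
  calc _ = 𝟙 _ ⊗≫ E.obj b a ◁ f ▷ E.obj a c ⊗≫
        (ev (E.pairing hab) ▷ (E.obj b c ⊗ E.obj c a ⊗ E.obj a c) ≫
          𝟙_ C ◁ (E.obj b c ◁ ev (E.pairing hac))) ⊗≫ 𝟙 _ := by monoidal
    _ = _ := by
      rw [← whisker_exchange]
      monoidal

theorem transpose_eq {a b c : V} (hab : a ≠ b) (hbc : b ≠ c) (hca : c ≠ a) (g : E.space a c b) :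
    E.transpose hab hbc hca g = E.inHom hab hbc g ▷ E.obj c a ≫ ev (E.pairing hca) := by
  simp [transpose, bendRight, tensorRightHomEquiv, Linear.homCongr_apply]
  simp [← unitors_equal]

/-- This exhibits the contraction `g^∨ f` as a closed loop on the edge `ac`, the shape of a quantum
trace. -/
theorem comp_transpose {a b c : V} (hab : a ≠ b) (hbc : b ≠ c) (hca : c ≠ a)
    (g : E.space a c b) (f : E.space a b c) :
    f ≫ E.transpose hab hbc hca g = coev (E.pairing hca.symm) ≫
      (E.outHom hca.symm f ≫ E.inHom hab hbc g) ▷ E.obj c a ≫ ev (E.pairing hca) := by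
  have hf : f = coev (E.pairing hca.symm) ≫ E.outHom hca.symm f ▷ E.obj c a := by
    exact (E.coev_outHom _ f).symm
  rw [transpose_eq, comp_whiskerRight, Category.assoc]
  conv_lhs => rw [hf]
  simp

/-- The composite which computes a negatively oriented 3-simplex. -/
theorem outHom_comp_inHom_rotate {a b c d : V} (hbc : b ≠ c) (hbd : b ≠ d)
    (hab : a ≠ b) (f : E.space b c d) (g : E.space a c b) :
    E.outHom hab g ▷ E.obj b d ≫ (α_ _ _ _).hom ≫
        E.obj a c ◁ E.inHom hbc.symm hbd (E.rotate hbc f) =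
      E.obj a b ◁ E.outHom hbd f ≫ (α_ _ _ _).inv ≫ E.inHom hab hbc g ▷ E.obj c d := by
  rw [inHom_rotate, inHom_eq]
  -- `outHom g` and `outHom f` act on different factors. After the exchange, `outHom g` meets the
  -- evaluation of `O(bc)`, and together they form `inHom g` by `inHom_eq`.
  calc _ = 𝟙 _ ⊗≫ (E.outHom hab g ▷ E.obj b d ≫
        (E.obj a c ⊗ E.obj c b) ◁ E.outHom hbd f) ⊗≫
          E.obj a c ◁ ev (E.pairing hbc) ▷ E.obj c d ⊗≫ 𝟙 _ := by monoidal
    _ = _ := by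
      rw [← whisker_exchange]
      monoidal

variable [Sovereign C] [GroupCategory k C]

/-- The two dimensions produced by the trace forms and the normalizing `dim(13)⁻¹` are all 1, so
only the scalar of the composite survives. -/
theorem tetraForm_eq (hdim : ∀ X : C, IsScalar k X → qdim k X = 1) (R : Representatives k C)
    {p : Fin 4 → V} (hp : Function.Injective p)
    (v₀ : E.space (p 1) (p 3) (p 2)) (v₁ : E.space (p 0) (p 2) (p 3))
    (v₂ : E.space (p 0) (p 3) (p 1)) (v₃ : E.space (p 0) (p 1) (p 2)) {t : k} (ht : t ≠ 0)
    (h : E.outHom (hp.ne (by decide)) v₁ ≫ E.outHom (hp.ne (by decide)) v₃ ▷ E.obj (p 2) (p 3) ≫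
        (α_ _ _ _).hom ≫
        E.obj (p 0) (p 1) ◁ E.inHom (hp.ne (by decide)) (hp.ne (by decide)) v₀ ≫
        E.inHom (hp.ne (by decide)) (hp.ne (by decide)) v₂ = t • 𝟙 _) :
    E.tetraForm R p hp v₀ v₁ v₂ v₃ = t := by
  rw [tetraForm, sixJForm_eq R (E.isScalar _ _) (E.isScalar _ _) (E.isScalar _ _)
    (E.isScalar _ _) (E.isScalar _ _) _ _ _ _ ht h]
  simp [hdim _ (E.isScalar _ _)]

end EdgeObjects

end Tensor

/-! ### The fusion morphisms `φ(g, h)` and coordinates with respect to them. -/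

theorem IsScalar.exists_smul_of_isIso {k : Type w} [Field k] {C : Type u} [Category.{v} C]
    [Abelian C] [Linear k C] {X Y : C} (hX : IsScalar k X) (f g : X ⟶ Y) [IsIso f] :
    ∃ t : k, g = t • f := by
  obtain ⟨t, ht⟩ := hX.2 (g ≫ inv f)
  refine ⟨t, ?_⟩
  rw [← cancel_mono (inv f), ← ht]
  simp

/-- On a positively oriented edge the two pairings are the right and the left duality of `X`, and
closing up with them is the definition of `leftTrace`. The flags are variables so that they can be
substituted by literal Booleans. -/
theorem coev_comp_ev_orientedPairing {C : Type u} [Category.{v} C] [MonoidalCategory C] [Sovereign C]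
    {X Y : C} {b b' : Bool} (h : b' = !b)
    (h' : b = !b') (hb : b = true) (f : orientedObj X Y b ⟶ orientedObj X Y b) :
    coev (orientedPairing X Y b b' h) ≫ f ▷ orientedObj Y X b' ≫
      ev (orientedPairing Y X b' b h') = leftTrace f := by
  subst hb
  subst h
  rfl

section Fusion

variable {k : Type w} [Field k] {C : Type u} [Category.{v} C] [Abelian C] [Linear k C]
  [MonoidalCategory C] [MonoidalPreadditive C] [MonoidalLinear k C]

/-- The contribution of a positive 3-simplex: the associativity relation `h` is composed with the
inverses of `f₁₂₃` and `f₀₁₃`, and the coordinates `uᵢ` factor out. -/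
theorem comp_eq_smul {X₀₁ X₁₂ X₂₃ X₀₂ X₁₃ X₀₃ : C} {f₀₁₂ : X₀₂ ⟶ X₀₁ ⊗ X₁₂}
    {f₀₂₃ : X₀₃ ⟶ X₀₂ ⊗ X₂₃} {f₀₁₃ : X₀₃ ⟶ X₀₁ ⊗ X₁₃} {f₁₂₃ : X₁₃ ⟶ X₁₂ ⊗ X₂₃} {t : k}
    (h : t • (f₀₁₃ ≫ X₀₁ ◁ f₁₂₃) = f₀₂₃ ≫ f₀₁₂ ▷ X₂₃ ≫ (α_ _ _ _).hom)
    [IsIso f₀₁₃] [IsIso f₁₂₃] (u₀ u₁ u₂ u₃ : k) :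
    (u₁ • f₀₂₃) ≫ (u₃ • f₀₁₂) ▷ X₂₃ ≫ (α_ _ _ _).hom ≫ X₀₁ ◁ (u₀ • inv f₁₂₃) ≫
      (u₂ • inv f₀₁₃) = (t * (u₃ * u₁ * u₂ * u₀)) • 𝟙 _ := by
  have h1 : f₀₂₃ ≫ f₀₁₂ ▷ X₂₃ ≫ (α_ _ _ _).hom ≫ X₀₁ ◁ (inv f₁₂₃) ≫ inv f₀₁₃ = t • 𝟙 _ := by
    have := congrArg (· ≫ X₀₁ ◁ inv f₁₂₃ ≫ inv f₀₁₃) h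
    simpa using this.symm
  simp only [MonoidalLinear.smul_whiskerRight, MonoidalLinear.whiskerLeft_smul,
    Linear.smul_comp, Linear.comp_smul, smul_smul, h1]
  congr 1
  ring

/-- The contribution of a negative 3-simplex: the same relation is read backwards. Now `f₀₁₂` and
`f₀₂₃` are inverted, so the scalar is `t⁻¹`. -/
theorem comp_eq_inv_smul {X₀₁ X₁₂ X₂₃ X₀₂ X₁₃ X₀₃ : C} {f₀₁₂ : X₀₂ ⟶ X₀₁ ⊗ X₁₂}
    {f₀₂₃ : X₀₃ ⟶ X₀₂ ⊗ X₂₃} {f₀₁₃ : X₀₃ ⟶ X₀₁ ⊗ X₁₃} {f₁₂₃ : X₁₃ ⟶ X₁₂ ⊗ X₂₃} {t : k}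
    (ht : t ≠ 0) (h : t • (f₀₁₃ ≫ X₀₁ ◁ f₁₂₃) = f₀₂₃ ≫ f₀₁₂ ▷ X₂₃ ≫ (α_ _ _ _).hom)
    [IsIso f₀₁₂] [IsIso f₀₂₃] (u₀ u₁ u₂ u₃ : k) :
    (u₁ • f₀₁₃) ≫ (X₀₁ ◁ (u₀ • f₁₂₃) ≫ (α_ _ _ _).inv ≫ (u₃ • inv f₀₁₂) ▷ X₂₃) ≫
      (u₂ • inv f₀₂₃) = (t⁻¹ * (u₃ * u₁ * u₂ * u₀)) • 𝟙 _ := by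
  have h0 : f₀₁₃ ≫ X₀₁ ◁ f₁₂₃ = t⁻¹ • (f₀₂₃ ≫ f₀₁₂ ▷ X₂₃ ≫ (α_ _ _ _).hom) := by
    rw [← h, smul_smul, inv_mul_cancel₀ ht, one_smul]
  have h1 : f₀₁₃ ≫ X₀₁ ◁ f₁₂₃ ≫ (α_ _ _ _).inv ≫ (inv f₀₁₂) ▷ X₂₃ ≫ inv f₀₂₃ = t⁻¹ • 𝟙 _ := by
    rw [← Category.assoc, h0]
    simp
  simp only [MonoidalLinear.smul_whiskerRight, MonoidalLinear.whiskerLeft_smul,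
    Linear.smul_comp, Linear.comp_smul, smul_smul, Category.assoc, h1]
  congr 1
  ring

theorem edgeObjects_obj [Sovereign C] {V : Type*} [LinearOrder V] (R : Representatives k C)
    (γ : V → V → ScalarClass k C) {a b : V} (h : a < b) :
    (edgeObjects R γ).obj a b = R.obj (γ a b) := by
  simp [edgeObjects, h, orientedObj]

variable [Sovereign C] [GroupCategory k C]

section

variable {R : Representatives k C}
  (φ : ∀ g h : ScalarClass k C, R.obj (g * h) ⟶ R.obj g ⊗ R.obj h)

/-- The morphism `φ(g, h)`, between objects which are equal to the representatives. -/
def fusionHom {X Y Z : C} {f g h : ScalarClass k C} (hfgh : f = g * h)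
    (hX : X = R.obj f) (hY : Y = R.obj g) (hZ : Z = R.obj h) : X ⟶ Y ⊗ Z :=
  eqToHom (hX.trans (congrArg R.obj hfgh)) ≫ φ g h ≫ (eqToHom hY.symm ⊗ₘ eqToHom hZ.symm)

variable {φ}

theorem isIso_fusionHom (hφ : ∀ g h, φ g h ≠ 0) {X Y Z : C} {f g h : ScalarClass k C}
    (hfgh : f = g * h) (hX : X = R.obj f) (hY : Y = R.obj g) (hZ : Z = R.obj h) :
    IsIso (fusionHom φ hfgh hX hY hZ) := by
  have := isIso_of_ne_zero (R.isScalar (g * h)) ((R.isScalar g).tensor (R.isScalar h)) (hφ g h)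
  unfold fusionHom
  infer_instance

/-- All objects and classes are variables tied by equations. Substituting these equations reduces
the relation to `hα` and avoids transport along equalities of objects. -/
theorem fusionHom_assoc {α : ScalarClass k C → ScalarClass k C → ScalarClass k C → kˣ}
    (hα : ∀ g h i, (α g h i : k) • (φ g (h * i) ≫ R.obj g ◁ φ h i) =
      eqToHom (by rw [mul_assoc]) ≫ φ (g * h) i ≫ φ g h ▷ R.obj i ≫ (α_ _ _ _).hom)
    {X₀₁ X₁₂ X₂₃ X₀₂ X₁₃ X₀₃ : C} {g₀₁ g₁₂ g₂₃ g₀₂ g₁₃ g₀₃ : ScalarClass k C}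
    (h₀₁ : X₀₁ = R.obj g₀₁) (h₁₂ : X₁₂ = R.obj g₁₂) (h₂₃ : X₂₃ = R.obj g₂₃)
    (h₀₂ : X₀₂ = R.obj g₀₂) (h₁₃ : X₁₃ = R.obj g₁₃) (h₀₃ : X₀₃ = R.obj g₀₃)
    (h₀₁₂ : g₀₂ = g₀₁ * g₁₂) (h₁₂₃ : g₁₃ = g₁₂ * g₂₃) (h₀₂₃ : g₀₃ = g₀₂ * g₂₃)
    (h₀₁₃ : g₀₃ = g₀₁ * g₁₃) :
    (α g₀₁ g₁₂ g₂₃ : k) • (fusionHom φ h₀₁₃ h₀₃ h₀₁ h₁₃ ≫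
        X₀₁ ◁ fusionHom φ h₁₂₃ h₁₃ h₁₂ h₂₃) =
      fusionHom φ h₀₂₃ h₀₃ h₀₂ h₂₃ ≫ fusionHom φ h₀₁₂ h₀₂ h₀₁ h₁₂ ▷ X₂₃ ≫ (α_ _ _ _).hom := by
  subst h₀₁ h₁₂ h₂₃ h₀₂ h₁₃ h₀₃ h₀₁₂ h₁₂₃
  -- What is left of `h₀₂₃` is an instance of associativity; it produces the one `eqToHom` that
  -- occurs in `hα`.
  subst h₀₁₃
  have h := hα g₀₁ g₁₂ g₂₃
  simpa [fusionHom] using h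

end

variable {V : Type*} [LinearOrder V] (R : Representatives k C) (γ : V → V → ScalarClass k C)

/-- As `a < c`, the loop of `comp_transpose` consists of the right coevaluation and the left
evaluation of the representative on `ac`, hence is its trace. -/
theorem contr_edgeObjects {a b c : V} (hab : a ≠ b) (hbc : b ≠ c) (hac : a < c)
    (g : (edgeObjects R γ).space a c b) (f : (edgeObjects R γ).space a b c) :
    (edgeObjects R γ).contr hab hbc hac.ne' g f = qtrace k _
      ((edgeObjects R γ).outHom hac.ne f ≫ (edgeObjects R γ).inHom hab hbc g) := by
  change (unitEquiv k C).symm (f ≫ (edgeObjects R γ).transpose hab hbc hac.ne' g) =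
    (unitEquiv k C).symm (leftTrace _)
  rw [EdgeObjects.comp_transpose]
  congr 1
  exact coev_comp_ev_orientedPairing _ _ (by simpa using hac) _

variable {R γ}

/-- The morphism `O(ac) ⟶ O(ab) ⊗ O(bc)` given by `φ(γ(ab), γ(bc))`. -/
def faceHom (φ : ∀ g h : ScalarClass k C, R.obj (g * h) ⟶ R.obj g ⊗ R.obj h) {a b c : V}
    (hab : a < b) (hbc : b < c) (h : γ a c = γ a b * γ b c) :
    (edgeObjects R γ).obj a c ⟶ (edgeObjects R γ).obj a b ⊗ (edgeObjects R γ).obj b c :=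
  fusionHom φ h (edgeObjects_obj R γ (hab.trans hbc)) (edgeObjects_obj R γ hab)
    (edgeObjects_obj R γ hbc)

theorem faceHom_assoc {φ : ∀ g h : ScalarClass k C, R.obj (g * h) ⟶ R.obj g ⊗ R.obj h}
    {α : ScalarClass k C → ScalarClass k C → ScalarClass k C → kˣ}
    (hα : ∀ g h i, (α g h i : k) • (φ g (h * i) ≫ R.obj g ◁ φ h i) =
      eqToHom (by rw [mul_assoc]) ≫ φ (g * h) i ≫ φ g h ▷ R.obj i ≫ (α_ _ _ _).hom)
    {a b c d : V} (hab : a < b) (hbc : b < c) (hcd : c < d)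
    (h₀₁₂ : γ a c = γ a b * γ b c) (h₁₂₃ : γ b d = γ b c * γ c d)
    (h₀₂₃ : γ a d = γ a c * γ c d) (h₀₁₃ : γ a d = γ a b * γ b d) :
    (α (γ a b) (γ b c) (γ c d) : k) • (faceHom φ hab (hbc.trans hcd) h₀₁₃ ≫
        (edgeObjects R γ).obj a b ◁ faceHom φ hbc hcd h₁₂₃) =
      faceHom φ (hab.trans hbc) hcd h₀₂₃ ≫
        faceHom φ hab hbc h₀₁₂ ▷ (edgeObjects R γ).obj c d ≫ (α_ _ _ _).hom :=
  fusionHom_assoc hα _ _ _ _ _ _ _ _ _ _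

/-- Both Hom-spaces are lines, so the basis vector is `t φ` and its dual is `s φ⁻¹`. Their
contraction is 1 by duality and `t s · dim O(ac) = t s` as a trace, so `s = t⁻¹`. -/
theorem exists_unit_basis (hdim : ∀ X : C, IsScalar k X → qdim k X = 1)
    (φ : ∀ g h : ScalarClass k C, R.obj (g * h) ⟶ R.obj g ⊗ R.obj h)
    {a b c : V} (hab : a < b) (hbc : b < c) (h : γ a c = γ a b * γ b c)
    [IsIso (faceHom φ hab hbc h)]
    (m : Fin (Module.finrank k ((edgeObjects R γ).space a b c))) :
    ∃ u : kˣ, (edgeObjects R γ).outHom (hab.trans hbc).ne ((edgeObjects R γ).basis a b c m) =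
        (u : k) • faceHom φ hab hbc h ∧
      (edgeObjects R γ).inHom hab.ne hbc.ne
          ((edgeObjects R γ).dualBasis hab.ne hbc.ne (hab.trans hbc).ne' m) =
        ((u⁻¹ : kˣ) : k) • inv (faceHom φ hab hbc h) := by
  obtain ⟨t, ht⟩ := ((edgeObjects R γ).isScalar a c).exists_smul_of_isIso (faceHom φ hab hbc h)
    ((edgeObjects R γ).outHom (hab.trans hbc).ne ((edgeObjects R γ).basis a b c m))
  obtain ⟨s, hs⟩ := (((edgeObjects R γ).isScalar a b).tensor
    ((edgeObjects R γ).isScalar b c)).exists_smul_of_isIso (inv (faceHom φ hab hbc h))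
    ((edgeObjects R γ).inHom hab.ne hbc.ne
      ((edgeObjects R γ).dualBasis hab.ne hbc.ne (hab.trans hbc).ne' m))
  have h1 : (edgeObjects R γ).contr hab.ne hbc.ne (hab.trans hbc).ne'
      ((edgeObjects R γ).dualBasis hab.ne hbc.ne (hab.trans hbc).ne' m)
      ((edgeObjects R γ).basis a b c m) = 1 := by
    rw [← EdgeObjects.contrEquiv_apply, EdgeObjects.dualBasis, LinearEquiv.apply_symm_apply]
    simp
  rw [contr_edgeObjects R γ hab.ne hbc.ne (hab.trans hbc), ht, hs] at h1
  have h2 : qtrace k _ (𝟙 ((edgeObjects R γ).obj a c)) = 1 :=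
    hdim _ ((edgeObjects R γ).isScalar a c)
  have hts : t * s = 1 := by
    simpa [smul_smul, h2, mul_comm] using h1
  exact ⟨⟨t, s, hts, by rw [mul_comm, hts]⟩, ht, hs⟩

end Fusion

/-! ### Coboundaries and the fundamental cycle. -/

section Combinatorics

variable {V : Type*}

theorem IsSimplex.comp {K : AbstractSimplicialComplex V} {m n : ℕ} {p : Fin n → V}
    (hp : IsSimplex K p) {f : Fin m → Fin n} (hf : Function.Injective f) (hm : m ≠ 0) :
    IsSimplex K (p ∘ f) := by
  classical
  obtain ⟨hinj, F, hF, hFp⟩ := hp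
  have := Fin.pos_iff_nonempty.1 (Nat.pos_of_ne_zero hm)
  refine ⟨hinj.comp hf, Finset.univ.image (p ∘ f), ?_,
    by rw [Finset.coe_image, Finset.coe_univ, Set.image_univ]⟩
  refine (K.isRelLowerSet_faces hF).2 ?_ (Finset.univ_nonempty.image _)
  rw [← Finset.coe_subset, hFp, Finset.coe_image, Finset.coe_univ, Set.image_univ]
  exact Set.range_comp_subset_range _ _

theorem IsSimplex.of_range_eq {K : AbstractSimplicialComplex V} {n : ℕ} {p q : Fin n → V}
    (hp : IsSimplex K p) (hq : Function.Injective q) (h : Set.range q = Set.range p) :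
    IsSimplex K q := by
  obtain ⟨-, F, hF, hFp⟩ := hp
  exact ⟨hq, F, hF, hFp.trans h.symm⟩

theorem IsSimplex.vec₂ {K : AbstractSimplicialComplex V} {n : ℕ} {p : Fin n → V}
    (hp : IsSimplex K p) {i j : Fin n} (hij : i ≠ j) : IsSimplex K ![p i, p j] := by
  have h := hp.comp (f := ![i, j]) (by
    intro x y; fin_cases x <;> fin_cases y <;> simp [hij, hij.symm]) (by simp)
  convert h using 1
  funext x; fin_cases x <;> rfl

theorem IsSimplex.vec₃ {K : AbstractSimplicialComplex V} {n : ℕ} {p : Fin n → V}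
    (hp : IsSimplex K p) {i j l : Fin n} (hij : i ≠ j) (hjl : j ≠ l) (hil : i ≠ l) :
    IsSimplex K ![p i, p j, p l] := by
  have h := hp.comp (f := ![i, j, l]) (by
    intro x y; fin_cases x <;> fin_cases y <;>
      simp [hij, hij.symm, hjl, hjl.symm, hil, hil.symm]) (by simp)
  convert h using 1
  funext x; fin_cases x <;> rfl

/-- The permutation which moves the vertex `i` to the last place. -/
def moveLast : Fin 4 → Equiv.Perm (Fin 4) :=
  ![Equiv.swap 0 1 * Equiv.swap 1 2 * Equiv.swap 2 3, Equiv.swap 1 2 * Equiv.swap 2 3,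
    Equiv.swap 2 3, 1]

theorem comp_moveLast (x : Fin 4 → V) (i : Fin 4) :
    x ∘ moveLast i = ![x (i.succAbove 0), x (i.succAbove 1), x (i.succAbove 2), x i] := by
  have h : ∀ i j : Fin 4, moveLast i j = ![i.succAbove 0, i.succAbove 1, i.succAbove 2, i] j := by
    decide
  funext j
  rw [Function.comp_apply, h]
  fin_cases j <;> rfl

variable [LinearOrder V]

/-- Every vertex added to an ascending 2-simplex gives an ascending 3-simplex. -/
theorem exists_tetra {K : AbstractSimplicialComplex V} {j : Fin 3 → V} (hj : StrictMono j) {d : V}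
    (hd : IsSimplex K ![j 0, j 1, j 2, d]) :
    ∃ (Δ : Tetra K) (i : Fin 4), Δ.1 ∘ i.succAbove = j ∧ Δ.1 i = d := by
  have h01 : j 0 < j 1 := hj (by decide)
  have h12 : j 1 < j 2 := hj (by decide)
  have hinj := hd.1
  have hd0 : j 0 ≠ d := hinj.ne (a₁ := 0) (a₂ := 3) (by decide)
  have hd1 : j 1 ≠ d := hinj.ne (a₁ := 1) (a₂ := 3) (by decide)
  have hd2 : j 2 ≠ d := hinj.ne (a₁ := 2) (a₂ := 3) (by decide)
  have key : ∀ (i : Fin 4) (x : Fin 4 → V), StrictMono x → x ∘ i.succAbove = j → x i = d →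
      -- The simplex condition depends only on the vertex set, so only the position `i` of `d` in
      -- the ascending order remains to be found.
      ∃ (Δ : Tetra K) (i : Fin 4), Δ.1 ∘ i.succAbove = j ∧ Δ.1 i = d := by
    intro i x hx hxj hxd
    refine ⟨⟨x, hx, hd.of_range_eq hx.injective ?_⟩, i, hxj, hxd⟩
    have : ![j 0, j 1, j 2, d] = x ∘ moveLast i := by
      rw [comp_moveLast, ← hxj, ← hxd]; rfl
    rw [this, EquivLike.range_comp]
  rcases lt_or_gt_of_ne hd0 with h0 | h0
  · rcases lt_or_gt_of_ne hd1 with h1 | h1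
    · rcases lt_or_gt_of_ne hd2 with h2 | h2
      · refine key 3 ![j 0, j 1, j 2, d] ?_ ?_ rfl
        · rw [Fin.strictMono_iff_lt_succ]; intro i; fin_cases i <;> simpa
        · funext i; fin_cases i <;> rfl
      · refine key 2 ![j 0, j 1, d, j 2] ?_ ?_ rfl
        · rw [Fin.strictMono_iff_lt_succ]; intro i; fin_cases i <;> simpa
        · funext i; fin_cases i <;> rfl
    · refine key 1 ![j 0, d, j 1, j 2] ?_ ?_ rfl
      · rw [Fin.strictMono_iff_lt_succ]; intro i; fin_cases i <;> simpa
      · funext i; fin_cases i <;> rfl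
  · refine key 0 ![d, j 0, j 1, j 2] ?_ ?_ rfl
    · rw [Fin.strictMono_iff_lt_succ]; intro i; fin_cases i <;> simpa
    · funext i; fin_cases i <;> rfl

theorem Tetra.isSimplex_face {K : AbstractSimplicialComplex V} (Δ : Tetra K) (i : Fin 4) :
    IsSimplex K (Δ.1 ∘ i.succAbove) :=
  Δ.2.2.comp Fin.succAbove_right_injective (by simp)

variable [Fintype V] {K : AbstractSimplicialComplex V}

/-- The sign with which a 2-simplex occurs in the boundary of a 3-simplex. -/
def faceSign (o : SimplicialOrientation K) (Δ : Tetra K) (i : Fin 4) : ℤ :=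
  o.sign (Δ.1 ∘ moveLast i)

/-- The pairs `(Δ, i)` whose face opposite to `i` is `j` correspond to the vertices `d` that
complete `j` to a 3-simplex, so this is the cycle condition at `j`. If `j` is not an ascending
2-simplex there are no such pairs. -/
theorem sum_faceSign (o : SimplicialOrientation K) (j : Fin 3 → V) :
    ∑ q : Tetra K × Fin 4 with q.1.1 ∘ q.2.succAbove = j, faceSign o q.1 q.2 = 0 := by
  classical
  by_cases hj : StrictMono j ∧ IsSimplex K j
  · have hj3 : ![j 0, j 1, j 2] = j := by
      funext i; fin_cases i <;> rfl
    rw [← o.cycle (j 0) (j 1) (j 2) (hj3 ▸ hj.2)]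
    have hvec : ∀ (Δ : Tetra K) (i : Fin 4), Δ.1 ∘ i.succAbove = j →
        Δ.1 ∘ moveLast i = ![j 0, j 1, j 2, Δ.1 i] := by
      rintro Δ i rfl
      exact comp_moveLast _ _
    refine Finset.sum_bij (fun q _ => q.1.1 q.2) ?_ ?_ ?_ ?_
    · rintro ⟨Δ, i⟩ hq
      simp only [Finset.mem_filter, Finset.mem_univ, true_and] at hq ⊢
      rw [← hvec Δ i hq]
      exact Δ.2.2.comp (moveLast i).injective (by simp)
    · rintro ⟨Δ, i⟩ hq ⟨Δ', i'⟩ hq' h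
      simp only [Finset.mem_filter, Finset.mem_univ, true_and] at hq hq' h
      have hr : Δ.1 = Δ'.1 := by
        rw [← Δ.2.1.range_inj Δ'.2.1, ← EquivLike.range_comp Δ.1 (moveLast i),
          ← EquivLike.range_comp Δ'.1 (moveLast i'), hvec Δ i hq, hvec Δ' i' hq', h]
      obtain rfl : Δ = Δ' := Subtype.ext hr
      rw [Δ.2.1.injective h]
    · intro d hd
      simp only [Finset.mem_filter, Finset.mem_univ, true_and] at hd
      obtain ⟨Δ, i, h1, h2⟩ := exists_tetra hj.1 hd
      exact ⟨(Δ, i), by simpa using h1, h2⟩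
    · rintro ⟨Δ, i⟩ hq
      simp only [Finset.mem_filter, Finset.mem_univ, true_and] at hq
      rw [faceSign, hvec Δ i hq]
  · refine Finset.sum_eq_zero ?_
    rintro ⟨Δ, i⟩ hq
    simp only [Finset.mem_filter, Finset.mem_univ, true_and] at hq
    subst hq
    exact absurd ⟨Δ.2.1.comp (Fin.strictMono_succAbove i), Δ.isSimplex_face i⟩ hj

/-- A multiplicative coboundary evaluates to `1` on the fundamental cycle. -/
theorem prod_coboundary (o : SimplicialOrientation K) {A : Type*} [CommGroup A]
    (u : V → V → V → A) :
    ∏ Δ : Tetra K, (u (Δ.1 0) (Δ.1 1) (Δ.1 2) * u (Δ.1 0) (Δ.1 2) (Δ.1 3) *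
      (u (Δ.1 0) (Δ.1 1) (Δ.1 3))⁻¹ * (u (Δ.1 1) (Δ.1 2) (Δ.1 3))⁻¹) ^ (o.sign Δ.1 : ℤ) = 1 := by
  classical
  let w : (Fin 3 → V) → A := fun j => u (j 0) (j 1) (j 2)
  have hsign : ∀ (Δ : Tetra K) i, faceSign o Δ i =
      (Equiv.Perm.sign (moveLast i) : ℤ) * (o.sign Δ.1 : ℤ) := by
    intro Δ i
    rw [faceSign, o.sign_perm _ Δ.2.2, Units.val_mul]
  -- Moving vertex `i` to the end takes `3 - i` transpositions, which yields the alternating signs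
  -- of the boundary.
  have hs : (Equiv.Perm.sign (moveLast 0) : ℤ) = -1 ∧ (Equiv.Perm.sign (moveLast 1) : ℤ) = 1 ∧
      (Equiv.Perm.sign (moveLast 2) : ℤ) = -1 ∧ (Equiv.Perm.sign (moveLast 3) : ℤ) = 1 := by
    decide
  have hΔ : ∀ Δ : Tetra K, (u (Δ.1 0) (Δ.1 1) (Δ.1 2) * u (Δ.1 0) (Δ.1 2) (Δ.1 3) *
      (u (Δ.1 0) (Δ.1 1) (Δ.1 3))⁻¹ * (u (Δ.1 1) (Δ.1 2) (Δ.1 3))⁻¹) ^ (o.sign Δ.1 : ℤ) =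
      ∏ i : Fin 4, w (Δ.1 ∘ i.succAbove) ^ faceSign o Δ i := by
    intro Δ
    simp only [hsign, Fin.prod_univ_four, hs.1, hs.2.1, hs.2.2.1, hs.2.2.2]
    have h0 : w (Δ.1 ∘ (0 : Fin 4).succAbove) = u (Δ.1 1) (Δ.1 2) (Δ.1 3) := rfl
    have h1 : w (Δ.1 ∘ (1 : Fin 4).succAbove) = u (Δ.1 0) (Δ.1 2) (Δ.1 3) := rfl
    have h2 : w (Δ.1 ∘ (2 : Fin 4).succAbove) = u (Δ.1 0) (Δ.1 1) (Δ.1 3) := rfl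
    have h3 : w (Δ.1 ∘ (3 : Fin 4).succAbove) = u (Δ.1 0) (Δ.1 1) (Δ.1 2) := rfl
    rw [h0, h1, h2, h3]
    simp only [mul_zpow, neg_one_mul, one_mul, zpow_neg, inv_zpow]
    ac_rfl
  -- Discrete Stokes: the factors are regrouped by the face `j`, and the total exponent of `w j` is
  -- the sum in `sum_faceSign`.
  rw [Finset.prod_congr rfl fun Δ _ => hΔ Δ,
    ← Fintype.prod_prod_type' (f := fun (Δ : Tetra K) i => w (Δ.1 ∘ i.succAbove) ^ faceSign o Δ i),
    ← Finset.prod_fiberwise _ (fun q : Tetra K × Fin 4 => q.1.1 ∘ q.2.succAbove)]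
  refine Finset.prod_eq_one fun j _ => ?_
  rw [Finset.prod_congr rfl (g := fun q : Tetra K × Fin 4 => w j ^ faceSign o q.1 q.2)]
  · have hpow : ∀ s : Finset (Tetra K × Fin 4),
        ∏ q ∈ s, w j ^ faceSign o q.1 q.2 = w j ^ ∑ q ∈ s, faceSign o q.1 q.2 := by
      intro s
      induction s using Finset.induction_on with
      | empty => simp
      | insert a s ha ih => rw [Finset.prod_insert ha, Finset.sum_insert ha, zpow_add, ih]
    rw [hpow, sum_faceSign, zpow_zero]
  · rintro ⟨Δ, i⟩ hq
    simp only [Finset.mem_filter, Finset.mem_univ, true_and] at hq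
    rw [hq]

end Combinatorics

/-! ### The state sum of a single color. -/

section StateSum

variable {k : Type w} [Field k] {C : Type u} [Category.{v} C] [Abelian C] [Linear k C]
  [MonoidalCategory C] [MonoidalPreadditive C] [MonoidalLinear k C]

namespace EdgeObjects

variable [FinitelySemisimple k C] {V : Type*} [LinearOrder V] {K : AbstractSimplicialComplex V}
  {E : EdgeObjects V k C} (s : E.State K)

theorem baseVec_of_lt {a b c : V} (hab : a < b) (hbc : b < c) (h : IsSimplex K ![a, b, c]) :
    E.baseVec s a b c = E.basis a b c (s ⟨(a, b, c), hab, hbc, h⟩) :=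
  dif_pos ⟨hab, hbc, h⟩

theorem baseVec_of_gt {a b c : V} (hab : a < b) (hbc : b < c) (h : IsSimplex K ![a, b, c]) :
    E.baseVec s a c b = E.dualBasis hab.ne hbc.ne (hab.trans hbc).ne'
      (s ⟨(a, b, c), hab, hbc, h⟩) := by
  rw [baseVec, dif_neg fun h' => hbc.not_gt h'.2.1, dif_pos ⟨hab, hbc, h⟩]

theorem faceVec_of_lt {x y z : V} (hyz : y ≠ z) (hzx : z ≠ x) (h : x < y) (h' : x < z) :
    E.faceVec s hyz hzx = E.baseVec s x y z :=
  if_pos ⟨h, h'⟩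

theorem faceVec_of_gt {x y z : V} (hyz : y ≠ z) (hzx : z ≠ x) (h : z < x) (h' : z < y) :
    E.faceVec s hyz hzx = E.rotate hzx (E.baseVec s z x y) := by
  rw [faceVec, if_neg fun h'' => h.not_gt h''.2, if_pos ⟨h, h'⟩]

end EdgeObjects

variable [Sovereign C] [GroupCategory k C] {V : Type*} [LinearOrder V]
  {K : AbstractSimplicialComplex V} {R : Representatives k C} {γ : V → V → ScalarClass k C}

/-- The cocycle condition on the ascending 2-simplices. -/
def IsFlat (K : AbstractSimplicialComplex V) (γ : V → V → ScalarClass k C) : Prop :=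
  ∀ a b c, a < b → b < c → IsSimplex K ![a, b, c] → γ a c = γ a b * γ b c

theorem finrank_space_eq_one {φ : ∀ g h : ScalarClass k C, R.obj (g * h) ⟶ R.obj g ⊗ R.obj h}
    {a b c : V} (hab : a < b) (hbc : b < c) (h : γ a c = γ a b * γ b c)
    [IsIso (faceHom φ hab hbc h)] :
    Module.finrank k ((edgeObjects R γ).space a b c) = 1 := by
  rw [((edgeObjects R γ).outHom (hab.trans hbc).ne).finrank_eq,
    (Linear.homCongr k (Iso.refl _) (asIso (faceHom φ hab hbc h)).symm).finrank_eq]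
  exact isScalar_iff_finrank.1 ((edgeObjects R γ).isScalar a c)

/-- A nonzero vector would give a nonzero morphism between simple objects, hence an isomorphism, and
the classes would agree. -/
theorem finrank_space_eq_zero {a b c : V} (hab : a < b) (hbc : b < c)
    (h : γ a c ≠ γ a b * γ b c) :
    Module.finrank k ((edgeObjects R γ).space a b c) = 0 := by
  rw [((edgeObjects R γ).outHom (hab.trans hbc).ne).finrank_eq]
  have hz : ∀ f : (edgeObjects R γ).obj a c ⟶
      (edgeObjects R γ).obj a b ⊗ (edgeObjects R γ).obj b c, f = 0 := by
    rw [edgeObjects_obj R γ hab, edgeObjects_obj R γ hbc, edgeObjects_obj R γ (hab.trans hbc)]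
    intro f
    by_contra hf
    have := isIso_of_ne_zero (R.isScalar _) ((R.isScalar _).tensor (R.isScalar _)) hf
    apply h
    rw [← R.mk_obj (γ a c), ← R.mk_obj (γ a b), ← R.mk_obj (γ b c)]
    exact (ScalarClass.mk_eq_mk _ ((R.isScalar _).tensor (R.isScalar _))).2 ⟨asIso f⟩
  have : Subsingleton ((edgeObjects R γ).obj a c ⟶
      (edgeObjects R γ).obj a b ⊗ (edgeObjects R γ).obj b c) :=
    ⟨fun f g => by rw [hz f, hz g]⟩
  exact Module.finrank_zero_of_subsingleton

/-- A 2-simplex where flatness fails has an empty basis, so the color has no state and the sum is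
empty. -/
theorem stateSum_eq_zero [Fintype V] (o : SimplicialOrientation K) (h : ¬ IsFlat K γ) :
    stateSum R o γ = 0 := by
  simp only [IsFlat, not_forall] at h
  obtain ⟨a, b, c, hab, hbc, hK, h⟩ := h
  have : IsEmpty ((edgeObjects R γ).State K) := by
    refine ⟨fun s => ?_⟩
    have i := s ⟨(a, b, c), hab, hbc, hK⟩
    have h0 : Module.finrank k ((edgeObjects R γ).space a b c) = 0 :=
      finrank_space_eq_zero hab hbc h
    rw [h0] at i
    exact i.elim0
  exact Fintype.sum_empty _

variable (φ : ∀ g h : ScalarClass k C, R.obj (g * h) ⟶ R.obj g ⊗ R.obj h)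
  [∀ {a b c : V} (hab : a < b) (hbc : b < c) (h : γ a c = γ a b * γ b c),
    IsIso (faceHom φ hab hbc h)]

/-- `u` gives the coordinates, with respect to `φ`, of the vectors of a state. -/
def IsCoordinates (hγ : IsFlat K γ) (s : (edgeObjects R γ).State K) (u : V → V → V → kˣ) : Prop :=
  ∀ (a b c : V) (hab : a < b) (hbc : b < c) (h : IsSimplex K ![a, b, c]),
    (edgeObjects R γ).outHom (hab.trans hbc).ne
        ((edgeObjects R γ).basis a b c (s ⟨(a, b, c), hab, hbc, h⟩)) =
      (u a b c : k) • faceHom φ hab hbc (hγ a b c hab hbc h) ∧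
    (edgeObjects R γ).inHom hab.ne hbc.ne ((edgeObjects R γ).dualBasis hab.ne hbc.ne
        (hab.trans hbc).ne' (s ⟨(a, b, c), hab, hbc, h⟩)) =
      (((u a b c)⁻¹ : kˣ) : k) • inv (faceHom φ hab hbc (hγ a b c hab hbc h))

theorem exists_isCoordinates (hdim : ∀ X : C, IsScalar k X → qdim k X = 1) (hγ : IsFlat K γ)
    (s : (edgeObjects R γ).State K) : ∃ u, IsCoordinates φ hγ s u := by
  classical
  have h := fun (a b c : V) (hab : a < b) (hbc : b < c) (h : IsSimplex K ![a, b, c]) =>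
    exists_unit_basis hdim φ hab hbc (hγ a b c hab hbc h) (s ⟨(a, b, c), hab, hbc, h⟩)
  choose u hu using h
  -- The value 1 off the ascending 2-simplices is arbitrary; it only makes `u` a total function, as
  -- `prod_coboundary` expects.
  refine ⟨fun a b c => if h : a < b ∧ b < c ∧ IsSimplex K ![a, b, c] then
    u a b c h.1 h.2.1 h.2.2 else 1, fun a b c hab hbc h => ?_⟩
  simp only [dif_pos (show a < b ∧ b < c ∧ IsSimplex K ![a, b, c] from ⟨hab, hbc, h⟩)]
  exact hu a b c hab hbc h

variable {φ}

/-- No rotation occurs here: the faces 012 and 023 carry basis vectors, the faces 013 and 123 carry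
dual vectors, and `comp_eq_smul` applies. -/
theorem tetraForm_faceVec_of_lt
    {α : ScalarClass k C → ScalarClass k C → ScalarClass k C → kˣ}
    (hα : ∀ g h i, (α g h i : k) • (φ g (h * i) ≫ R.obj g ◁ φ h i) =
      eqToHom (by rw [mul_assoc]) ≫ φ (g * h) i ≫ φ g h ▷ R.obj i ≫ (α_ _ _ _).hom)
    (hdim : ∀ X : C, IsScalar k X → qdim k X = 1) {hγ : IsFlat K γ}
    {s : (edgeObjects R γ).State K} {u : V → V → V → kˣ}
    (hu : IsCoordinates φ hγ s u) {p : Fin 4 → V}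
    (hp : Function.Injective p) (hK : IsSimplex K p) (h₀₁ : p 0 < p 1) (h₁₂ : p 1 < p 2)
    (h₂₃ : p 2 < p 3) :
    (edgeObjects R γ).tetraForm R p hp
      ((edgeObjects R γ).faceVec s (hp.ne (by decide)) (hp.ne (by decide)))
      ((edgeObjects R γ).faceVec s (hp.ne (by decide)) (hp.ne (by decide)))
      ((edgeObjects R γ).faceVec s (hp.ne (by decide)) (hp.ne (by decide)))
      ((edgeObjects R γ).faceVec s (hp.ne (by decide)) (hp.ne (by decide))) =
    ((α (γ (p 0) (p 1)) (γ (p 1) (p 2)) (γ (p 2) (p 3)) *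
      (u (p 0) (p 1) (p 2) * u (p 0) (p 2) (p 3) *
        (u (p 0) (p 1) (p 3))⁻¹ * (u (p 1) (p 2) (p 3))⁻¹) : kˣ) : k) := by
  have h₀₂ := h₀₁.trans h₁₂
  have h₁₃ := h₁₂.trans h₂₃
  have h₀₃ := h₀₁.trans h₁₃
  have K₀₁₂ : IsSimplex K ![p 0, p 1, p 2] := hK.vec₃ (by decide) (by decide) (by decide)
  have K₀₂₃ : IsSimplex K ![p 0, p 2, p 3] := hK.vec₃ (by decide) (by decide) (by decide)
  have K₀₁₃ : IsSimplex K ![p 0, p 1, p 3] := hK.vec₃ (by decide) (by decide) (by decide)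
  have K₁₂₃ : IsSimplex K ![p 1, p 2, p 3] := hK.vec₃ (by decide) (by decide) (by decide)
  refine EdgeObjects.tetraForm_eq _ hdim R hp _ _ _ _ (Units.ne_zero _) ?_
  rw [EdgeObjects.faceVec_of_lt s _ _ h₁₃ h₁₂, EdgeObjects.faceVec_of_lt s _ _ h₀₂ h₀₃,
    EdgeObjects.faceVec_of_lt s _ _ h₀₃ h₀₁, EdgeObjects.faceVec_of_lt s _ _ h₀₁ h₀₂,
    EdgeObjects.baseVec_of_gt s h₁₂ h₂₃ K₁₂₃, EdgeObjects.baseVec_of_lt s h₀₂ h₂₃ K₀₂₃,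
    EdgeObjects.baseVec_of_gt s h₀₁ h₁₃ K₀₁₃, EdgeObjects.baseVec_of_lt s h₀₁ h₁₂ K₀₁₂,
    (hu _ _ _ h₁₂ h₂₃ K₁₂₃).2, (hu _ _ _ h₀₂ h₂₃ K₀₂₃).1, (hu _ _ _ h₀₁ h₁₃ K₀₁₃).2,
    (hu _ _ _ h₀₁ h₁₂ K₀₁₂).1,
    comp_eq_smul (faceHom_assoc hα h₀₁ h₁₂ h₂₃ (hγ _ _ _ h₀₁ h₁₂ K₀₁₂) (hγ _ _ _ h₁₂ h₂₃ K₁₂₃)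
      (hγ _ _ _ h₀₂ h₂₃ K₀₂₃) (hγ _ _ _ h₀₁ h₁₃ K₀₁₃))]
  simp only [Units.val_mul]

/-- Here the ascending order is `p 0, p 2, p 1, p 3`. Compared with a positive simplex, basis and
dual vectors change places on all four faces, which accounts for the inverse; the vector opposite to
`p 0` is moreover rotated. -/
theorem tetraForm_faceVec_of_gt
    {α : ScalarClass k C → ScalarClass k C → ScalarClass k C → kˣ}
    (hα : ∀ g h i, (α g h i : k) • (φ g (h * i) ≫ R.obj g ◁ φ h i) =
      eqToHom (by rw [mul_assoc]) ≫ φ (g * h) i ≫ φ g h ▷ R.obj i ≫ (α_ _ _ _).hom)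
    (hdim : ∀ X : C, IsScalar k X → qdim k X = 1) {hγ : IsFlat K γ}
    {s : (edgeObjects R γ).State K} {u : V → V → V → kˣ}
    (hu : IsCoordinates φ hγ s u) {p : Fin 4 → V}
    (hp : Function.Injective p) (hK : IsSimplex K p) (h₀₂ : p 0 < p 2) (h₂₁ : p 2 < p 1)
    (h₁₃ : p 1 < p 3) :
    (edgeObjects R γ).tetraForm R p hp
      ((edgeObjects R γ).faceVec s (hp.ne (by decide)) (hp.ne (by decide)))
      ((edgeObjects R γ).faceVec s (hp.ne (by decide)) (hp.ne (by decide)))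
      ((edgeObjects R γ).faceVec s (hp.ne (by decide)) (hp.ne (by decide)))
      ((edgeObjects R γ).faceVec s (hp.ne (by decide)) (hp.ne (by decide))) =
    (((α (γ (p 0) (p 2)) (γ (p 2) (p 1)) (γ (p 1) (p 3)) *
      (u (p 0) (p 2) (p 1) * u (p 0) (p 1) (p 3) *
        (u (p 0) (p 2) (p 3))⁻¹ * (u (p 2) (p 1) (p 3))⁻¹))⁻¹ : kˣ) : k) := by
  have h₀₁ := h₀₂.trans h₂₁
  have h₂₃ := h₂₁.trans h₁₃
  have h₀₃ := h₀₁.trans h₁₃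
  have K₀₂₁ : IsSimplex K ![p 0, p 2, p 1] := hK.vec₃ (by decide) (by decide) (by decide)
  have K₀₁₃ : IsSimplex K ![p 0, p 1, p 3] := hK.vec₃ (by decide) (by decide) (by decide)
  have K₀₂₃ : IsSimplex K ![p 0, p 2, p 3] := hK.vec₃ (by decide) (by decide) (by decide)
  have K₂₁₃ : IsSimplex K ![p 2, p 1, p 3] := hK.vec₃ (by decide) (by decide) (by decide)
  refine EdgeObjects.tetraForm_eq _ hdim R hp _ _ _ _ (Units.ne_zero _) ?_
  rw [EdgeObjects.faceVec_of_gt s _ _ h₂₁ h₂₃, EdgeObjects.faceVec_of_lt s _ _ h₀₂ h₀₃,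
    EdgeObjects.faceVec_of_lt s _ _ h₀₃ h₀₁, EdgeObjects.faceVec_of_lt s _ _ h₀₁ h₀₂,
    EdgeObjects.baseVec_of_lt s h₂₁ h₁₃ K₂₁₃, EdgeObjects.baseVec_of_lt s h₀₂ h₂₃ K₀₂₃,
    EdgeObjects.baseVec_of_gt s h₀₁ h₁₃ K₀₁₃, EdgeObjects.baseVec_of_gt s h₀₂ h₂₁ K₀₂₁]
  -- The rotated vector is absorbed, leaving a composite through the inverse associator to which
  -- `comp_eq_inv_smul` applies.
  have key := EdgeObjects.outHom_comp_inHom_rotate (edgeObjects R γ) h₂₁.ne h₂₃.ne h₀₂.ne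
    ((edgeObjects R γ).basis _ _ _ (s ⟨(_, _, _), h₂₁, h₁₃, K₂₁₃⟩))
    ((edgeObjects R γ).dualBasis h₀₂.ne h₂₁.ne h₀₁.ne' (s ⟨(_, _, _), h₀₂, h₂₁, K₀₂₁⟩))
  have key' := congrArg (fun f => (edgeObjects R γ).outHom h₀₃.ne
    ((edgeObjects R γ).basis _ _ _ (s ⟨(_, _, _), h₀₂, h₂₃, K₀₂₃⟩)) ≫ f ≫
    (edgeObjects R γ).inHom h₀₁.ne h₁₃.ne ((edgeObjects R γ).dualBasis h₀₁.ne h₁₃.ne h₀₃.ne'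
      (s ⟨(_, _, _), h₀₁, h₁₃, K₀₁₃⟩))) key
  simp only [Category.assoc] at key'
  refine key'.trans ?_
  rw [(hu _ _ _ h₂₁ h₁₃ K₂₁₃).1, (hu _ _ _ h₀₂ h₂₃ K₀₂₃).1, (hu _ _ _ h₀₁ h₁₃ K₀₁₃).2,
    (hu _ _ _ h₀₂ h₂₁ K₀₂₁).2]
  have h := comp_eq_inv_smul (Units.ne_zero _) (faceHom_assoc hα h₀₂ h₂₁ h₁₃
    (hγ _ _ _ h₀₂ h₂₁ K₀₂₁) (hγ _ _ _ h₂₁ h₁₃ K₂₁₃) (hγ _ _ _ h₀₁ h₁₃ K₀₁₃)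
    (hγ _ _ _ h₀₂ h₂₃ K₀₂₃))
    (u (p 2) (p 1) (p 3)) (u (p 0) (p 2) (p 3)) ((u (p 0) (p 1) (p 3))⁻¹ : kˣ)
    ((u (p 0) (p 2) (p 1))⁻¹ : kˣ)
  simp only [Category.assoc] at h
  refine h.trans ?_
  congr 1
  simp only [Units.val_mul, Units.val_inv_eq_inv_val, mul_inv, inv_inv]
  ring

theorem stateSum_eq_prod [Fintype V]
    {α : ScalarClass k C → ScalarClass k C → ScalarClass k C → kˣ}
    (hα : ∀ g h i, (α g h i : k) • (φ g (h * i) ≫ R.obj g ◁ φ h i) =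
      eqToHom (by rw [mul_assoc]) ≫ φ (g * h) i ≫ φ g h ▷ R.obj i ≫ (α_ _ _ _).hom)
    (hdim : ∀ X : C, IsScalar k X → qdim k X = 1) (hγ : IsFlat K γ)
    (o : SimplicialOrientation K) :
    stateSum R o γ = ∏ Δ : Tetra K,
      (((α (γ (Δ.1 0) (Δ.1 1)) (γ (Δ.1 1) (Δ.1 2)) (γ (Δ.1 2) (Δ.1 3))) ^
        ((o.sign Δ.1 : ℤˣ) : ℤ) : kˣ) : k) := by
  have hone : ∀ F : Face K, Module.finrank k
      ((edgeObjects R γ).space F.1.1 F.1.2.1 F.1.2.2) = 1 := fun F =>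
    finrank_space_eq_one (φ := φ) F.2.1 F.2.2.1 (hγ _ _ _ F.2.1 F.2.2.1 F.2.2.2)
  -- All the spaces are lines, so this is the only state.
  let s : (edgeObjects R γ).State K := fun F => ⟨0, by rw [hone F]; exact one_pos⟩
  obtain ⟨u, hu⟩ := exists_isCoordinates φ hdim hγ s
  rw [stateSum, Fintype.sum_eq_single s]
  · have hterm : ∀ Δ : Tetra K, (have hp := positiveNumbering_injective o Δ
        (edgeObjects R γ).tetraForm R (positiveNumbering o Δ) hp
          ((edgeObjects R γ).faceVec s (hp.ne (by decide)) (hp.ne (by decide)))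
          ((edgeObjects R γ).faceVec s (hp.ne (by decide)) (hp.ne (by decide)))
          ((edgeObjects R γ).faceVec s (hp.ne (by decide)) (hp.ne (by decide)))
          ((edgeObjects R γ).faceVec s (hp.ne (by decide)) (hp.ne (by decide)))) =
        (((α (γ (Δ.1 0) (Δ.1 1)) (γ (Δ.1 1) (Δ.1 2)) (γ (Δ.1 2) (Δ.1 3)) *
          (u (Δ.1 0) (Δ.1 1) (Δ.1 2) * u (Δ.1 0) (Δ.1 2) (Δ.1 3) *
            (u (Δ.1 0) (Δ.1 1) (Δ.1 3))⁻¹ * (u (Δ.1 1) (Δ.1 2) (Δ.1 3))⁻¹)) ^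
          ((o.sign Δ.1 : ℤˣ) : ℤ) : kˣ) : k) := by
      intro Δ
      have h₀₁ : Δ.1 0 < Δ.1 1 := Δ.2.1 (by decide)
      have h₁₂ : Δ.1 1 < Δ.1 2 := Δ.2.1 (by decide)
      have h₂₃ : Δ.1 2 < Δ.1 3 := Δ.2.1 (by decide)
      rcases Int.units_eq_one_or (o.sign Δ.1) with h | h
      · have hp : positiveNumbering o Δ = Δ.1 := if_pos h
        rw [h, Units.val_one, zpow_one]
        exact (tetraForm_faceVec_of_lt hα hdim hu (positiveNumbering_injective o Δ)
          (by rw [hp]; exact Δ.2.2) (by rw [hp]; exact h₀₁) (by rw [hp]; exact h₁₂)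
          (by rw [hp]; exact h₂₃)).trans (by rw [hp])
      · have hp : positiveNumbering o Δ = Δ.1 ∘ Equiv.swap (1 : Fin 4) 2 :=
          if_neg (by rw [h]; decide)
        rw [h, Units.val_neg, Units.val_one, zpow_neg_one]
        exact (tetraForm_faceVec_of_gt hα hdim hu (positiveNumbering_injective o Δ)
          (by rw [hp]; exact Δ.2.2.comp (Equiv.injective _) (by simp))
          (by rw [hp]; exact h₀₁) (by rw [hp]; exact h₁₂)
          (by rw [hp]; exact h₂₃)).trans (by rw [hp]; rfl)
    rw [Finset.prod_congr rfl fun Δ _ => hterm Δ]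
    -- The dependence on the chosen bases is a coboundary and disappears from the product.
    rw [← Units.coe_prod, ← Units.coe_prod, Finset.prod_congr rfl fun Δ _ => mul_zpow _ _ _,
      Finset.prod_mul_distrib, prod_coboundary o u, mul_one]
  · intro s' hs'
    refine absurd (funext fun F => ?_) hs'
    have : Subsingleton (Fin (Module.finrank k
      ((edgeObjects R γ).space F.1.1 F.1.2.1 F.1.2.2))) := by
      rw [hone F]; infer_instance
    exact Subsingleton.elim _ _

end StateSum

/-! ### Flatness on ascending and on arbitrary oriented 2-simplices. -/

section Colors

variable {V : Type*} [LinearOrder V] {K : AbstractSimplicialComplex V} {G : Type*} [Group G]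
  {γ : V → V → G}

/-- The cocycle condition on the ascending 2-simplices implies it on all oriented 2-simplices. -/
theorem cocycle_of_ascending (hinv : ∀ a b, IsSimplex K ![a, b] → γ b a = (γ a b)⁻¹)
    (h : ∀ a b c, a < b → b < c → IsSimplex K ![a, b, c] → γ a c = γ a b * γ b c) {a b c : V}
    (hK : IsSimplex K ![a, b, c]) : γ a b * γ b c * γ c a = 1 := by
  have hab : a ≠ b := hK.1.ne (a₁ := 0) (a₂ := 1) (by decide)
  have hbc : b ≠ c := hK.1.ne (a₁ := 1) (a₂ := 2) (by decide)
  have hac : a ≠ c := hK.1.ne (a₁ := 0) (a₂ := 2) (by decide)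
  have iab : γ b a = (γ a b)⁻¹ := hinv _ _ (hK.vec₂ (i := 0) (j := 1) (by decide))
  have ibc : γ c b = (γ b c)⁻¹ := hinv _ _ (hK.vec₂ (i := 1) (j := 2) (by decide))
  have ica : γ a c = (γ c a)⁻¹ := hinv _ _ (hK.vec₂ (i := 2) (j := 0) (by decide))
  have key : γ a c = γ a b * γ b c → γ a b * γ b c * γ c a = 1 := by
    intro e
    rw [← e, ica, inv_mul_cancel]
  apply key
  -- Of the eight sign patterns two are cyclic and impossible; the other six are the orderings of
  -- the triangle, each reduced to its ascending relation by inverting edges.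
  rcases lt_or_gt_of_ne hab with h1 | h1 <;> rcases lt_or_gt_of_ne hbc with h2 | h2 <;>
    rcases lt_or_gt_of_ne hac with h3 | h3
  · exact h _ _ _ h1 h2 hK
  · exact absurd (h1.trans h2) h3.not_gt
  · rw [h _ _ _ h3 h2 (hK.vec₃ (i := 0) (j := 2) (l := 1) (by decide) (by decide) (by decide)), ibc]
    group
  · have := h _ _ _ h3 h1 (hK.vec₃ (i := 2) (j := 0) (l := 1) (by decide) (by decide) (by decide))
    rw [ibc] at this
    rw [ica, inv_eq_iff_eq_inv.1 this]
    group
  · rw [h _ _ _ h1 h3 (hK.vec₃ (i := 1) (j := 0) (l := 2) (by decide) (by decide) (by decide)), iab]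
    group
  · have := h _ _ _ h2 h3 (hK.vec₃ (i := 1) (j := 2) (l := 0) (by decide) (by decide) (by decide))
    rw [iab] at this
    rw [ica, inv_eq_iff_eq_inv.1 this]
    group
  · exact absurd (h2.trans h1) h3.not_gt
  · have := h _ _ _ h2 h1 (hK.vec₃ (i := 2) (j := 1) (l := 0) (by decide) (by decide) (by decide))
    rw [ica, this, iab, ibc]
    group

end Colors

theorem Color.ascending {V : Type*} {K : AbstractSimplicialComplex V} {G : Type*} [Group G]
    (γ : Color G K) {a b c : V} (hK : IsSimplex K ![a, b, c]) :
    γ.1 a c = γ.1 a b * γ.1 b c := by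
  have h := γ.2.2.2 a b c hK
  rw [γ.2.2.1 a c (hK.vec₂ (i := 0) (j := 2) (by decide)), mul_inv_eq_one] at h
  exact h.symm

end DWTV
end

/-! ### Comparison of the two sums over colors. -/

open DWTV
theorem mainTheorem1 {k : Type w} [Field k] [IsAlgClosed k] [CharZero k]
    {C : Type u} [Category.{v} C] [Abelian C] [Linear k C]
    [MonoidalCategory C] [MonoidalPreadditive C] [MonoidalLinear k C]
    [Sovereign C] [GroupCategory k C]
    (hdim : ∀ X : C, IsScalar k X → qdim k X = 1)
    (R : Representatives k C)
    (α : ScalarClass k C → ScalarClass k C → ScalarClass k C → kˣ)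
    (hα : IsCocycle α) (hαC : IsAssociativityConstraint R α)
    {M : Type*} [TopologicalSpace M] [T2Space M] [CompactSpace M]
    [ChartedSpace (EuclideanSpace ℝ (Fin 3)) M]
    {V : Type*} [Fintype V] [LinearOrder V]
    (T : Triangulation V M) (o : SimplicialOrientation T.complex) :
    dijkgraafWitten α T o = turaevViro R T o := by
  obtain ⟨φ, hφ, hα'⟩ := hαC
  have hR : ∀ g, qdim k (R.obj g) = 1 := fun g => hdim _ (R.isScalar g)
  have hI : ∀ (γ : V → V → ScalarClass k C) {a b c : V} (hab : a < b) (hbc : b < c)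
      (h : γ a c = γ a b * γ b c), IsIso (faceHom (R := R) φ hab hbc h) :=
    fun γ _ _ _ _ _ h => isIso_fusionHom hφ h _ _ _
  simp only [dijkgraafWitten, turaevViro, hR, one_pow, Finset.prod_const_one, one_mul,
    Finset.sum_const, Finset.card_univ, nsmul_eq_mul, mul_one, Nat.card_eq_fintype_card]
  congr 1
  -- Inverse and identity of `Λ_C` are by definition the dual and the unit class, so this map merely
  -- forgets flatness.
  let e : Color (ScalarClass k C) T.complex → TVColor k C T.complex :=
    fun γ => ⟨γ.1, γ.2.1, γ.2.2.1⟩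
  -- It remains to see that colors outside the image contribute 0 and that the terms agree on the
  -- image.
  refine Fintype.sum_of_injective e (fun γ γ' h => Subtype.ext
    (congrArg (fun x : TVColor k C T.complex => x.1) h)) _ _ ?_ ?_
  · intro γ hγ
    refine stateSum_eq_zero o fun hflat => hγ ⟨⟨γ.1, γ.2.1, γ.2.2, fun a b c hK => ?_⟩, rfl⟩
    exact cocycle_of_ascending γ.2.2 hflat hK
  · intro γ
    have := @hI γ.1
    have hflat : IsFlat T.complex γ.1 := fun a b c _ _ hK => Color.ascending γ hK
    exact (stateSum_eq_prod hα' hdim hflat o).symm
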